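/- Let $d\ge 2$, let $G=U(1)$ and regard $\mathbb Z^d$ as the cubical cell complex decomposing $\mathbb R^d$, with its standard orientation of cells. For a subcomplex $K$ and an Abelian group $A$ let $C^k(K;A)$ be the group of $k$-cochains and $d_k:C^k(K;A)\to C^{k+1}(K;A)$ the cellular coboundary. Identify the Lie algebra of $U(1)$ with $\mathbb R$ through $\exp(t)=e^{2\pi i t}$. Let $\mathcal F$ be the set of finite subcomplexes $K$ of $\mathbb Z^d$ whose underlying space is a contractible (hence connected) topological $d$-manifold with boundary, ordered by inclusion. For $K\in\mathcal F$ put $I_K^G=\mathrm{Im}(d_1:C^1(K;G)\to C^2(K;G))$, a torus with Lie algebra $I_K=\mathrm{Im}(d_1:C^1(K;\mathbb R)\to C^2(K;\mathbb R))$, which carries the Euclidean inner product of $C^2(K;\mathbb R)$; for a character $\chi$ of $I_K^G$ let $J_K(\chi)\in I_K^*$ be the functional with $\chi(e^{2\pi i X})=e^{2\pi i J_K(\chi)(X)}$ for $X\in I_K$. Let $I^G$ be the projective limit of the compact groups $I_K^G$ under restriction, $\mathcal H$ the projective limit of the Hilbert spaces $I_K$ under restriction in the category of Hilbert spaces and linear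 contractions, and $J:\widehat{I^G}\to\mathcal H^*$ the homomorphism induced by the $J_K$ (a character of $I^G$ that comes from a character $\psi$ of $I^G_K$ is sent to the composition of $J_K(\psi)$ with the canonical map $\mathcal H\to I_K$). For $\beta>0$ let $\mu^H_\beta$ be the Borel probability measure on $I^G$ with $$\int \overline{\chi}\,d\mu^H_\beta=\exp\bigl(-4\pi^2\beta\,\|J(\chi)\|^2_{\mathcal H^*}\bigr)\qquad\text{for all characters }\chi\text{ of }I^G,$$ and let $\mu_{\beta,\mathbb Z^d}$ be the push-forward of $\mu^H_\beta$ under the inverse of the map $C^1(\mathbb Z^d;G)/C^0(\mathbb Z^d;G)\to I^G$ induced by $d_1$, where $C^0$ acts on $C^1$ through $d_0$. For a 2-cell $p$ let $\overline W_p$ be the $U(1)$-valued function on $C^1(\mathbb Z^d;G)/C^0(\mathbb Z^d;G)$ induced by $W_p(c)=(d_1c)(p)$, and for 2-cells $p,q$ set $$O_\beta(p,q)=\int \overline W_p\,\overline W_q\,d\mu_{\beta,\mathbb Z^d}-\Bigl(\int\overline W_p\,d\mu_{\beta,\mathbb Z^d}\Bigr)\Bigl(\int\overline W_q\,d\mu_{\beta,\mathbb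 Z^d}\Bigr).$$ Then, for all $\beta>0$ and all 2-cells $p,q$ of $\mathbb Z^d$, $$O_\beta(p,q)=e^{-4\pi^2\beta\left(\|\Pi\delta_p\|^2_{\ell^2}+\|\Pi\delta_q\|^2_{\ell^2}\right)}\left(e^{-8\pi^2\beta\langle\delta_p,\Pi\delta_q\rangle_{\ell^2}}-1\right),$$ where $\delta_p$ is the real 2-cochain which is $1$ at $p$ and $0$ elsewhere, and $\Pi$ is the orthogonal projection of the Hilbert space of square-summable real 2-cochains on $\mathbb Z^d$ onto the closure of the image of $d_1$ on square-summable real 1-cochains. -/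

import Mathlib

noncomputable section

namespace CubicalLattice

open MeasureTheory

/-! ### Cells and subcomplexes of the cubical lattice `ℤ^d` -/

/-- The cell `(v, S)` is the cube with lowest vertex `v` spanned by the directions in `S`, with the
orientation given by the increasing order of `S`; its dimension is `#S`. -/
abbrev Cell (d : ℕ) : Type := (Fin d → ℤ) × Finset (Fin d)

/-- The face of a cell orthogonal to the direction `i` that contains the lowest vertex. -/
def Cell.lower {d : ℕ} (σ : Cell d) (i : Fin d) : Cell d := (σ.1, σ.2.erase i)

/-- The face opposite to `Cell.lower σ i`. -/
def Cell.upper {d : ℕ} (σ : Cell d) (i : Fin d) : Cell d := (σ.1 + Pi.single i 1, σ.2.erase i)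

/-- The closed cell as a subset of `ℝ^d`. -/
def Cell.closedCell {d : ℕ} (σ : Cell d) : Set (Fin d → ℝ) :=
  {x | ∀ i, (σ.1 i : ℝ) ≤ x i ∧ x i ≤ (σ.1 i : ℝ) + (if i ∈ σ.2 then 1 else 0)}

/-- A (finite or infinite) cell subcomplex of `ℤ^d`: a set of cells closed under taking faces. -/
structure Subcomplex (d : ℕ) where
  cells : Set (Cell d)
  lower_mem : ∀ σ ∈ cells, ∀ i ∈ σ.2, Cell.lower σ i ∈ cells
  upper_mem : ∀ σ ∈ cells, ∀ i ∈ σ.2, Cell.upper σ i ∈ cells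

/-- The whole cubical lattice `ℤ^d`. -/
def lattice (d : ℕ) : Subcomplex d where
  cells := Set.univ
  lower_mem := fun _ _ _ _ => trivial
  upper_mem := fun _ _ _ _ => trivial

namespace Subcomplex

variable {d : ℕ}

/-- The underlying space of a subcomplex, a subspace of `ℝ^d`. -/
def realization (K : Subcomplex d) : Set (Fin d → ℝ) :=
  {x | ∃ σ ∈ K.cells, x ∈ Cell.closedCell σ}

/-- The `k`-cells of `K`. -/
abbrev KCell (K : Subcomplex d) (k : ℕ) : Type := {σ : Cell d // σ ∈ K.cells ∧ σ.2.card = k}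

variable (K : Subcomplex d) {k : ℕ}

def lowerFace (σ : K.KCell (k + 1)) (i : {i // i ∈ σ.1.2}) : K.KCell k :=
  ⟨Cell.lower σ.1 i, K.lower_mem _ σ.2.1 _ i.2, by
    simp [Cell.lower, Finset.card_erase_of_mem i.2, σ.2.2]⟩

def upperFace (σ : K.KCell (k + 1)) (i : {i // i ∈ σ.1.2}) : K.KCell k :=
  ⟨Cell.upper σ.1 i, K.upper_mem _ σ.2.1 _ i.2, by
    simp [Cell.upper, Finset.card_erase_of_mem i.2, σ.2.2]⟩

/-- The incidence number of a cell with its upper face in direction `i`; the incidence number with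
the lower face is the negative of it. -/
def incidence (σ : K.KCell (k + 1)) (i : {i // i ∈ σ.1.2}) : ℤ :=
  (-1) ^ (σ.1.2.filter (fun j => j < i.1)).card

/-- The cellular coboundary `C^k(K; A) → C^{k+1}(K; A)` for an Abelian group `A`, written
multiplicatively (`mulCoboundary`) or additively (`addCoboundary`). -/
@[to_additive]
def mulCoboundary (K : Subcomplex d) (k : ℕ) (A : Type) [CommGroup A] :
    (K.KCell k → A) →* (K.KCell (k + 1) → A) where
  toFun c σ := ∏ i : {i // i ∈ σ.1.2},
    (c (K.upperFace σ i) / c (K.lowerFace σ i)) ^ K.incidence σ i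
  map_one' := by
    funext σ
    simp
  map_mul' c c' := by
    funext σ
    simp only [Pi.mul_apply]
    rw [← Finset.prod_mul_distrib]
    refine Finset.prod_congr rfl fun i _ => ?_
    rw [← mul_zpow, mul_div_mul_comm]

/-- The square-summable real `k`-cochains on `K`, with the Euclidean inner product. If `K` is
finite, these are all real `k`-cochains. -/
abbrev L2Cochain (K : Subcomplex d) (k : ℕ) : Type := lp (fun _ : K.KCell k => ℝ) 2

theorem memlp_addCoboundary (c : K.L2Cochain k) :
    Memℓp (K.addCoboundary k ℝ c : K.KCell (k + 1) → ℝ) 2 := by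
  have hs : Summable fun τ : K.KCell k => ‖c τ‖ ^ 2 := by
    have := (memℓp_gen_iff (p := 2) (by norm_num)).1 (lp.memℓp c)
    simpa using this
  have hp : Summable fun x : K.KCell k × Fin d => ‖c x.1‖ ^ 2 := by
    rw [← (Equiv.prodComm _ _).summable_iff]
    refine (summable_prod_of_nonneg (fun x => sq_nonneg _)).2 ⟨fun i => hs, ?_⟩
    exact (hasSum_fintype _).summable
  have key : ∀ f : (σ : K.KCell (k + 1)) → {i // i ∈ σ.1.2} → K.KCell k,
      (∀ σ σ' i i', (f σ i) = f σ' i' → i.1 = i'.1 → σ = σ') →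
      Summable fun σ : K.KCell (k + 1) => ∑ i : {i // i ∈ σ.1.2}, ‖c (f σ i)‖ ^ 2 := by
    intro f hf
    have h1 : Function.Injective
        (fun x : (Σ σ : K.KCell (k + 1), {i // i ∈ σ.1.2}) => (f x.1 x.2, x.2.1)) := by
      rintro ⟨σ, i⟩ ⟨σ', i'⟩ h
      have h2 := congrArg Prod.fst h
      have h3 := congrArg Prod.snd h
      simp only at h2 h3
      have := hf _ _ _ _ h2 h3
      subst this
      simp only [Sigma.mk.injEq, heq_eq_eq, true_and]
      exact Subtype.ext h3
    have h2 := (hp.comp_injective h1).sigma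
    simpa [tsum_fintype] using h2
  have herase : ∀ (σ σ' : K.KCell (k + 1)) (i : {i // i ∈ σ.1.2}) (i' : {i // i ∈ σ'.1.2}),
      σ.1.2.erase i = σ'.1.2.erase i' → i.1 = i'.1 → σ.1.2 = σ'.1.2 := by
    intro σ σ' i i' h hi
    rw [← Finset.insert_erase i.2, ← Finset.insert_erase i'.2, h, hi]
  have hu := key K.upperFace (by
    intro σ σ' i i' h hi
    have h' := congrArg Subtype.val h
    simp only [upperFace, Cell.upper, Prod.mk.injEq] at h'
    refine Subtype.ext (Prod.ext ?_ (herase _ _ _ _ h'.2 hi))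
    have := h'.1
    rw [hi] at this
    exact add_right_cancel this)
  have hl := key K.lowerFace (by
    intro σ σ' i i' h hi
    have h' := congrArg Subtype.val h
    simp only [lowerFace, Cell.lower, Prod.mk.injEq] at h'
    exact Subtype.ext (Prod.ext h'.1 (herase _ _ _ _ h'.2 hi)))
  refine memℓp_gen ?_
  have hb := ((hu.add hl).mul_left (2 * ((k : ℝ) + 1)))
  refine Summable.of_nonneg_of_le (fun σ => by positivity) (fun σ => ?_) hb
  have h2 : ((2 : ENNReal).toReal) = ((2 : ℕ) : ℝ) := by norm_num
  rw [h2, Real.rpow_natCast, ← Finset.sum_add_distrib]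
  simp only [addCoboundary, AddMonoidHom.coe_mk, ZeroHom.coe_mk]
  have hcard : (Finset.univ : Finset {i // i ∈ σ.1.2}).card = k + 1 := by
    rw [Finset.card_univ, Fintype.card_coe, σ.2.2]
  have h3 := sq_sum_le_card_mul_sum_sq (s := (Finset.univ : Finset {i // i ∈ σ.1.2}))
    (f := fun i => K.incidence σ i • (c (K.upperFace σ i) - c (K.lowerFace σ i)))
  rw [hcard] at h3
  rw [Real.norm_eq_abs, sq_abs]
  refine h3.trans ?_
  rw [mul_comm (2 : ℝ), mul_assoc, Finset.mul_sum (a := (2 : ℝ))]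
  push_cast
  have hk : (0 : ℝ) ≤ (k : ℝ) + 1 := by positivity
  refine mul_le_mul_of_nonneg_left (Finset.sum_le_sum fun i _ => ?_) hk
  have h4 : (K.incidence σ i : ℝ) ^ 2 = 1 := by
    simp only [incidence]
    push_cast
    rw [← pow_mul, mul_comm, pow_mul]
    norm_num
  rw [zsmul_eq_mul, mul_pow, h4, Real.norm_eq_abs, Real.norm_eq_abs, sq_abs, sq_abs]
  nlinarith [sq_nonneg (c (K.upperFace σ i) + c (K.lowerFace σ i))]

/-- The coboundary operator between square-summable real cochains. -/
def l2Coboundary (K : Subcomplex d) (k : ℕ) : K.L2Cochain k →ₗ[ℝ] K.L2Cochain (k + 1) where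
  toFun c := ⟨K.addCoboundary k ℝ c, K.memlp_addCoboundary c⟩
  map_add' c c' := by
    apply Subtype.ext
    exact map_add (K.addCoboundary k ℝ) (c : K.KCell k → ℝ) c'
  map_smul' r c := by
    apply Subtype.ext
    funext σ
    change K.addCoboundary k ℝ (r • (c : K.KCell k → ℝ)) σ = r * K.addCoboundary k ℝ c σ
    simp only [addCoboundary, AddMonoidHom.coe_mk, ZeroHom.coe_mk, Finset.mul_sum, Pi.smul_apply,
      smul_eq_mul, zsmul_eq_mul]
    exact Finset.sum_congr rfl fun i _ => by ring

/-- The image of `d_1` in the `U(1)`-valued 2-cochains on `K`. -/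
def imGroup (K : Subcomplex d) : Subgroup (K.KCell 2 → Circle) := (K.mulCoboundary 1 Circle).range

/-- The image of `d_1` in the real square-summable 2-cochains on `K`. For finite `K` this is the Lie
algebra of `imGroup K`, with the Euclidean inner product. -/
def imLie (K : Subcomplex d) : Submodule ℝ (K.L2Cochain 2) := LinearMap.range (K.l2Coboundary 1)

/-- The exponential map `imLie K → imGroup K`, `X ↦ e^{2πiX}`; the Lie algebra of `U(1)` is
identified with `ℝ` in such a way that the kernel of the exponential map of `U(1)` is `ℤ`. -/
def expMap (K : Subcomplex d) (X : K.imLie) : K.imGroup :=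
  ⟨fun σ => Circle.exp (2 * Real.pi * (X : K.L2Cochain 2) σ), by
    obtain ⟨c, hc⟩ := X.2
    refine ⟨fun τ => Circle.exp (2 * Real.pi * c τ), ?_⟩
    funext σ
    rw [← hc]
    change _ = Circle.exp (2 * Real.pi * K.addCoboundary 1 ℝ c σ)
    simp only [mulCoboundary, addCoboundary, AddMonoidHom.coe_mk, ZeroHom.coe_mk,
      MonoidHom.coe_mk, OneHom.coe_mk, Finset.mul_sum]
    have h : ∀ (s : Finset {i // i ∈ σ.1.2}) (f : {i // i ∈ σ.1.2} → ℝ),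
        Circle.exp (∑ i ∈ s, f i) = ∏ i ∈ s, Circle.exp (f i) := fun s f => by
      induction s using Finset.cons_induction with
      | empty => simp
      | cons a s ha ih => rw [Finset.sum_cons, Finset.prod_cons, Circle.exp_add, ih]
    rw [h]
    refine Finset.prod_congr rfl fun i _ => ?_
    rw [← Circle.exp_sub, ← Circle.exp_zsmul]
    congr 1
    simp only [zsmul_eq_mul]
    ring⟩

/-- Finite subcomplexes whose underlying space is a contractible (in particular connected)
topological `d`-manifold with boundary. -/
structure IsAdmissible [NeZero d] (K : Subcomplex d) : Prop where
  finite : K.cells.Finite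
  contractible : ContractibleSpace K.realization
  manifold : Nonempty (ChartedSpace (EuclideanHalfSpace d) K.realization)

/-- A cell of `K` regarded as a cell of the lattice. -/
def incl (K : Subcomplex d) (k : ℕ) (σ : K.KCell k) : (lattice d).KCell k :=
  ⟨σ.1, trivial, σ.2.2⟩

theorem incl_injective (K : Subcomplex d) (k : ℕ) : Function.Injective (K.incl k) :=
  fun _ _ h => Subtype.ext (congrArg (fun τ => τ.1) h)

/-- Restriction of `U(1)`-valued cochains from `ℤ^d` to `K`. -/
def restrictGroup (K : Subcomplex d) (k : ℕ) :
    ((lattice d).KCell k → Circle) →ₜ* (K.KCell k → Circle) where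
  toFun x σ := x (K.incl k σ)
  map_one' := rfl
  map_mul' _ _ := rfl
  continuous_toFun := by fun_prop

/-- Restriction of square-summable real cochains from `ℤ^d` to `K`. -/
def restrictL2 (K : Subcomplex d) (k : ℕ) : (lattice d).L2Cochain k →L[ℝ] K.L2Cochain k :=
  LinearMap.mkContinuous
    { toFun := fun x => (⟨fun σ => x (K.incl k σ), by
        have h := (memℓp_gen_iff (p := 2) (by norm_num)).1 (lp.memℓp x)
        exact memℓp_gen (h.comp_injective (K.incl_injective k))⟩ : K.L2Cochain k)
      map_add' := fun _ _ => rfl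
      map_smul' := fun _ _ => rfl } 1 (fun x => by
    have h := (memℓp_gen_iff (p := 2) (by norm_num)).1 (lp.memℓp x)
    rw [one_mul, lp.norm_eq_tsum_rpow (by norm_num), lp.norm_eq_tsum_rpow (by norm_num)]
    refine Real.rpow_le_rpow (tsum_nonneg fun _ => by positivity) ?_ (by norm_num)
    exact (h.comp_injective (K.incl_injective k)).tsum_le_tsum_of_inj (K.incl k)
      (K.incl_injective k) (fun _ _ => by positivity) (fun _ => le_rfl) h)

end Subcomplex

open Subcomplex

/-! ### Heat kernel measures -/

/-- For a compact Abelian group `G`, a real Hilbert space `H` and `J : Ĝ → H*`: `μ` is a Borel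
probability measure on `G` with Fourier transform `χ ↦ exp (-4π²β‖J χ‖²)`. -/
def IsHeatKernelMeasure {G H : Type} [CommGroup G] [TopologicalSpace G] [MeasurableSpace G]
    [BorelSpace G] [NormedAddCommGroup H] [InnerProductSpace ℝ H] (J : PontryaginDual G → StrongDual ℝ H) (β : ℝ)
    (μ : Measure G) : Prop :=
  IsProbabilityMeasure μ ∧ ∀ χ : PontryaginDual G,
    ∫ x, (starRingEnd ℂ) (χ x : ℂ) ∂μ =
      ((Real.exp (-4 * Real.pi ^ 2 * β * ‖J χ‖ ^ 2) : ℝ) : ℂ)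

/-- The heat kernel measure associated to `(G, H, J)`. -/
def heatKernelMeasure {G H : Type} [CommGroup G] [TopologicalSpace G] [MeasurableSpace G]
    [BorelSpace G] [NormedAddCommGroup H] [InnerProductSpace ℝ H] (J : PontryaginDual G → StrongDual ℝ H) (β : ℝ) :
    Measure G :=
  Classical.epsilon (IsHeatKernelMeasure J β)

variable {d : ℕ}

/-- The differential of a character of `imGroup K`, divided by `2πi`: the functional `l` on the Lie
algebra `imLie K` with `χ (exp X) = e^{2πi l(X)}`. -/
def charDifferential (K : Subcomplex d) (χ : PontryaginDual K.imGroup) : StrongDual ℝ K.imLie :=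
  Classical.epsilon fun l : StrongDual ℝ K.imLie =>
    ∀ X : K.imLie, χ (K.expMap X) = Circle.exp (2 * Real.pi * l X)

/-! ### The projective limit over the admissible subcomplexes -/

section limit

variable (d) [NeZero d]

/-- The directed set (under inclusion) of admissible finite subcomplexes of `ℤ^d`. -/
abbrev Admissible : Type := {K : Subcomplex d // K.IsAdmissible}

/-- The projective limit of the compact groups `imGroup K` under restriction: a family of cochains
on all admissible `K` that is compatible with restrictions is a cochain on `ℤ^d`. -/
def limitGroup : Subgroup ((lattice d).KCell 2 → Circle) :=
  ⨅ K : Admissible d, (K.1.imGroup).comap (K.1.restrictGroup 2).toMonoidHom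

/-- The projective limit of the Hilbert spaces `imLie K` under restriction, in the category of
Hilbert spaces and contractions: the bounded families of cochains on all admissible `K` that are
compatible with restrictions, with the norm `sup_K ‖x|_K‖`, that is, square-summable cochains on
`ℤ^d`. -/
def limitHilbert : Submodule ℝ ((lattice d).L2Cochain 2) :=
  ⨅ K : Admissible d, (K.1.imLie).comap (K.1.restrictL2 2 : _ →ₗ[ℝ] K.1.L2Cochain 2)

instance : MeasurableSpace (limitGroup d) := borel _

instance : BorelSpace (limitGroup d) := ⟨rfl⟩

variable {d}

theorem restrictGroup_mem (K : Admissible d) (x : limitGroup d) :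
    K.1.restrictGroup 2 x.1 ∈ K.1.imGroup :=
  (Subgroup.mem_iInf.1 x.2) K

theorem restrictL2_mem (K : Admissible d) (x : limitHilbert d) :
    K.1.restrictL2 2 x.1 ∈ K.1.imLie :=
  ((Submodule.mem_iInf _).1 x.2) K

/-- The canonical map from the limit group to `imGroup K`. -/
def groupProj (K : Admissible d) : limitGroup d →ₜ* K.1.imGroup where
  toFun x := ⟨K.1.restrictGroup 2 x.1, restrictGroup_mem K x⟩
  map_one' := rfl
  map_mul' _ _ := rfl
  continuous_toFun :=
    ((K.1.restrictGroup 2).continuous_toFun.comp continuous_subtype_val).subtype_mk _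

/-- The canonical contraction from the limit Hilbert space to `imLie K`. -/
def hilbertProj (K : Admissible d) : limitHilbert d →L[ℝ] K.1.imLie :=
  ((K.1.restrictL2 2).comp (limitHilbert d).subtypeL).codRestrict K.1.imLie (restrictL2_mem K)

/-- The limit of the maps `charDifferential K`. A character of the limit group comes from a
character `ψ` of some `imGroup K`, and is sent to the functional on the limit Hilbert space induced
by `charDifferential K ψ`. -/
def limitJ (χ : PontryaginDual (limitGroup d)) : StrongDual ℝ (limitHilbert d) :=
  Classical.epsilon fun l : StrongDual ℝ (limitHilbert d) =>
    ∃ (K : Admissible d) (ψ : PontryaginDual K.1.imGroup),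
      χ = PontryaginDual.map (groupProj K) ψ ∧
      l = (charDifferential K.1 ψ).comp (hilbertProj K)

end limit

/-! ### The gauge theory measure on `C^1(ℤ^d; U(1)) / C^0(ℤ^d; U(1))` -/

/-- `1`-cochains modulo gauge transformations: the gauge group `C^0` acts through `d_0`. -/
abbrev GaugeOrbits (d : ℕ) : Type :=
  ((lattice d).KCell 1 → Circle) ⧸ ((lattice d).mulCoboundary 0 Circle).range

instance (d : ℕ) : MeasurableSpace (GaugeOrbits d) := borel _

instance (d : ℕ) : BorelSpace (GaugeOrbits d) := ⟨rfl⟩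

theorem coboundary_coboundary (K : Subcomplex d) (c : K.KCell 0 → Circle) :
    K.mulCoboundary 1 Circle (K.mulCoboundary 0 Circle c) = 1 := by
  have h1 : ∀ (τ : K.KCell 1) (b : Fin d) (hb : τ.1.2 = {b}),
      K.mulCoboundary 0 Circle c τ =
        c (K.upperFace τ ⟨b, by simp [hb]⟩) / c (K.lowerFace τ ⟨b, by simp [hb]⟩) := by
    rintro ⟨⟨v, T⟩, hT⟩ b hb
    simp only at hb
    subst hb
    simp only [mulCoboundary, MonoidHom.coe_mk, OneHom.coe_mk]
    rw [Fintype.prod_eq_single (⟨b, by simp⟩ : {i // i ∈ ({b} : Finset (Fin d))})]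
    · simp [incidence, Finset.filter_singleton]
    · rintro ⟨i, hi⟩ hne
      exact absurd (Subtype.ext (Finset.mem_singleton.1 hi)) hne
  funext σ
  obtain ⟨a, b, hab, hS⟩ : ∃ a b : Fin d, a < b ∧ σ.1.2 = {a, b} := by
    obtain ⟨a, b, hne, h⟩ := Finset.card_eq_two.1 σ.2.2
    rcases lt_or_gt_of_ne hne with h' | h'
    · exact ⟨a, b, h', h⟩
    · exact ⟨b, a, h', by rw [h, Finset.pair_comm]⟩
  obtain ⟨⟨v, S⟩, hσ⟩ := σ
  simp only at hS
  subst hS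
  have ha : a ∈ ({a, b} : Finset (Fin d)) := by simp
  have hb : b ∈ ({a, b} : Finset (Fin d)) := by simp
  have hne : a ≠ b := hab.ne
  have hea : ({a, b} : Finset (Fin d)).erase a = {b} := by
    ext i; simp; grind
  have heb : ({a, b} : Finset (Fin d)).erase b = {a} := by
    ext i; simp; grind
  set σ : K.KCell 2 := ⟨(v, {a, b}), hσ⟩ with hσd
  change (∏ i : {i // i ∈ ({a, b} : Finset (Fin d))}, _) = (1 : Circle)
  rw [Fintype.prod_eq_mul (⟨a, ha⟩ : {i // i ∈ ({a, b} : Finset (Fin d))}) ⟨b, hb⟩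
    (by simpa using hne) (by
      rintro ⟨i, hi⟩ ⟨h2, h3⟩
      simp at hi h2 h3
      tauto)]
  have ia : K.incidence σ ⟨a, ha⟩ = 1 := by
    simp only [incidence, hσd]
    rw [Finset.filter_eq_empty_iff.2]
    · simp
    · intro x hx
      simp at hx
      rcases hx with rfl | rfl
      · simp
      · exact not_lt.2 hab.le
  have ib : K.incidence σ ⟨b, hb⟩ = -1 := by
    simp only [incidence, hσd]
    rw [show ({a, b} : Finset (Fin d)).filter (fun j => j < b) = {a} by ext i; simp; grind]
    simp
  rw [ia, ib]
  rw [h1 (K.upperFace σ ⟨a, ha⟩) b hea, h1 (K.lowerFace σ ⟨a, ha⟩) b hea,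
    h1 (K.upperFace σ ⟨b, hb⟩) a heb, h1 (K.lowerFace σ ⟨b, hb⟩) a heb]
  have e0 : ∀ τ τ' : K.KCell 0, τ.1.1 = τ'.1.1 → c τ = c τ' := by
    intro τ τ' h
    refine congrArg c (Subtype.ext (Prod.ext h ?_))
    rw [Finset.card_eq_zero.1 τ.2.2, Finset.card_eq_zero.1 τ'.2.2]
  have m1 : b ∈ (K.upperFace σ ⟨a, ha⟩).1.2 := by
    change b ∈ ({a, b} : Finset (Fin d)).erase a
    simp [hea]
  have m2 : b ∈ (K.lowerFace σ ⟨a, ha⟩).1.2 := m1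
  have m3 : a ∈ (K.upperFace σ ⟨b, hb⟩).1.2 := by
    change a ∈ ({a, b} : Finset (Fin d)).erase b
    simp [heb]
  have m4 : a ∈ (K.lowerFace σ ⟨b, hb⟩).1.2 := m3
  rw [e0 (K.upperFace (K.upperFace σ ⟨a, ha⟩) ⟨b, m1⟩) (K.upperFace (K.upperFace σ ⟨b, hb⟩) ⟨a, m3⟩)
      (add_right_comm _ _ _),
    e0 (K.lowerFace (K.upperFace σ ⟨a, ha⟩) ⟨b, m1⟩) (K.upperFace (K.lowerFace σ ⟨b, hb⟩) ⟨a, m4⟩) rfl,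
    e0 (K.upperFace (K.lowerFace σ ⟨a, ha⟩) ⟨b, m2⟩) (K.lowerFace (K.upperFace σ ⟨b, hb⟩) ⟨a, m3⟩) rfl,
    e0 (K.lowerFace (K.lowerFace σ ⟨a, ha⟩) ⟨b, m2⟩) (K.lowerFace (K.lowerFace σ ⟨b, hb⟩) ⟨a, m4⟩) rfl]
  rw [zpow_one, zpow_neg, zpow_one, div_div_div_comm, mul_inv_cancel]

/-- The Wilson loop variable of the plaquette `p`: the product of the values of a `1`-cochain around
the boundary of `p`. -/
def wilson (p : (lattice d).KCell 2) : ((lattice d).KCell 1 → Circle) →* Circle :=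
  (Pi.evalMonoidHom _ p).comp ((lattice d).mulCoboundary 1 Circle)

/-- The map on gauge orbits induced by `wilson p`. -/
def wilsonBar (p : (lattice d).KCell 2) : GaugeOrbits d →* Circle :=
  QuotientGroup.lift _ (wilson p) (by
    rintro _ ⟨c, rfl⟩
    exact congrFun (coboundary_coboundary (lattice d) c) p)

theorem coboundary_mem_limitGroup [NeZero d] (c : (lattice d).KCell 1 → Circle) :
    (lattice d).mulCoboundary 1 Circle c ∈ limitGroup d :=
  Subgroup.mem_iInf.2 fun K => ⟨K.1.restrictGroup 1 c, rfl⟩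

/-- The map from gauge orbits to the limit group induced by `d_1`. -/
def dBar (d : ℕ) [NeZero d] : GaugeOrbits d →* limitGroup d :=
  QuotientGroup.lift _
    (((lattice d).mulCoboundary 1 Circle).codRestrict (limitGroup d) coboundary_mem_limitGroup) (by
      rintro _ ⟨c, rfl⟩
      exact Subtype.ext (coboundary_coboundary (lattice d) c))

/-- The measure `μ_{β,ℤ^d}`: the push-forward of the limit heat kernel measure under the inverse of
`dBar`. -/
def gaugeMeasure (d : ℕ) [NeZero d] (β : ℝ) : Measure (GaugeOrbits d) :=
  (heatKernelMeasure (limitJ (d := d)) β).map (Function.invFun (dBar d))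

/-- The connected two-point function of the plaquette variables. -/
def connectedTwoPoint [NeZero d] (β : ℝ) (p q : (lattice d).KCell 2) : ℂ :=
  ∫ x, (wilsonBar p x : ℂ) * (wilsonBar q x : ℂ) ∂(gaugeMeasure d β) -
    (∫ x, (wilsonBar p x : ℂ) ∂(gaugeMeasure d β)) * (∫ x, (wilsonBar q x : ℂ) ∂(gaugeMeasure d β))

/-- The cochain that is `1` at `p` and `0` elsewhere. -/
def delta (p : (lattice d).KCell 2) : (lattice d).L2Cochain 2 := lp.single 2 p (1 : ℝ)

/-- The orthogonal projection of the square-summable real 2-cochains on `ℤ^d` onto the closure of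
the image of `d_1` on square-summable 1-cochains. -/
def exactProj (d : ℕ) : (lattice d).L2Cochain 2 →L[ℝ] (lattice d).L2Cochain 2 :=
  (LinearMap.range ((lattice d).l2Coboundary 1)).topologicalClosure.starProjection

end CubicalLattice

end

noncomputable section

/-! ### The closed ball as a topological manifold with boundary -/

namespace CubicalLattice

open Metric

variable {d : ℕ} [NeZero d]

theorem norm_sq_add_smul_single (u : EuclideanSpace ℝ (Fin d)) (s : ℝ) :
    ‖u + s • EuclideanSpace.single (0 : Fin d) (1 : ℝ)‖ ^ 2 = ‖u‖ ^ 2 + 2 * (s * u 0) + s ^ 2 := by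
  rw [norm_add_sq_real, inner_smul_right, norm_smul, mul_pow]
  simp [EuclideanSpace.inner_single_right]

/-- Inversion at the boundary point `s • e₀`, `s = ±1`, identifies the closed unit ball without this
point with the half-space. -/
def ballMinusPointHomeomorph (s : ℝ) (hs : s * s = 1) :
    {y : closedBall (0 : EuclideanSpace ℝ (Fin d)) 1 //
      y.1 ≠ s • EuclideanSpace.single (0 : Fin d) (1 : ℝ)} ≃ₜ EuclideanHalfSpace d where
  toFun y := ⟨(-(s * (‖y.1.1 - s • EuclideanSpace.single (0 : Fin d) (1 : ℝ)‖ ^ 2)⁻¹)) •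
      (y.1.1 - s • EuclideanSpace.single (0 : Fin d) (1 : ℝ)) -
        (1 / 2 : ℝ) • EuclideanSpace.single (0 : Fin d) (1 : ℝ), by
    obtain ⟨⟨y, hy⟩, hne⟩ := y
    simp only at hne ⊢
    obtain ⟨u, rfl⟩ : ∃ u, y = u + s • EuclideanSpace.single (0 : Fin d) (1 : ℝ) :=
      ⟨_, (sub_add_cancel _ _).symm⟩
    have hu : u ≠ 0 := by rintro rfl; simp at hne
    have h1 : ‖u‖ ^ 2 + 2 * (s * u 0) + s ^ 2 ≤ 1 := by
      rw [← norm_sq_add_smul_single]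
      rw [mem_closedBall_zero_iff] at hy
      nlinarith [norm_nonneg (u + s • EuclideanSpace.single (0 : Fin d) (1 : ℝ))]
    have h2 : 0 < ‖u‖ ^ 2 := by positivity
    have h3 : ‖u‖ ^ 2 ≤ -2 * (s * u 0) := by nlinarith
    have h4 : 1 ≤ (‖u‖ ^ 2)⁻¹ * (-2 * (s * u 0)) := by
      rw [← inv_mul_cancel₀ h2.ne']
      gcongr
    simp
    linarith⟩
  invFun h := ⟨⟨(-(s * (‖h.1 + (1 / 2 : ℝ) • EuclideanSpace.single (0 : Fin d) (1 : ℝ)‖ ^ 2)⁻¹)) •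
      (h.1 + (1 / 2 : ℝ) • EuclideanSpace.single (0 : Fin d) (1 : ℝ)) +
        s • EuclideanSpace.single (0 : Fin d) (1 : ℝ), by
    obtain ⟨h, hh⟩ := h
    simp only
    obtain ⟨k, rfl⟩ : ∃ k, h = k - (1 / 2 : ℝ) • EuclideanSpace.single (0 : Fin d) (1 : ℝ) :=
      ⟨_, (add_sub_cancel_right _ _).symm⟩
    have hk : 1 / 2 ≤ k 0 := by simpa using hh
    have hk0 : k ≠ 0 := by rintro rfl; norm_num at hk
    have h2 : 0 < ‖k‖ ^ 2 := by positivity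
    rw [sub_add_cancel, mem_closedBall_zero_iff]
    refine abs_le_of_sq_le_sq' ?_ zero_le_one |>.2
    rw [norm_sq_add_smul_single, norm_smul, mul_pow, Real.norm_eq_abs, sq_abs]
    have h3 : (-(s * (‖k‖ ^ 2)⁻¹)) ^ 2 * ‖k‖ ^ 2 = (s * s) * (‖k‖ ^ 2)⁻¹ := by
      field_simp
    simp only [PiLp.smul_apply, smul_eq_mul]
    have h4 : 2 * (s * (-(s * (‖k‖ ^ 2)⁻¹) * k 0)) = -((s * s) * ((‖k‖ ^ 2)⁻¹ * (2 * k 0))) := by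
      ring
    rw [h3, h4, show s ^ 2 = 1 by rw [pow_two, hs], hs]
    have h5 : (‖k‖ ^ 2)⁻¹ * 1 ≤ (‖k‖ ^ 2)⁻¹ * (2 * k 0) := by
      gcongr; linarith
    linarith⟩, by
    obtain ⟨h, hh⟩ := h
    simp only
    intro h1
    rw [add_eq_right, smul_eq_zero] at h1
    have hk : (h + (1 / 2 : ℝ) • EuclideanSpace.single (0 : Fin d) (1 : ℝ)) ≠ 0 := by
      intro h2
      have := congrArg (fun x : EuclideanSpace ℝ (Fin d) => x 0) h2
      simp at this
      linarith
    have hs0 : s ≠ 0 := by rintro rfl; norm_num at hs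
    simp only [neg_eq_zero, mul_eq_zero, hs0, inv_eq_zero, hk, false_or, or_false] at h1
    exact hk (norm_eq_zero.1 (pow_eq_zero_iff two_ne_zero |>.1 h1))⟩
  left_inv := by
    rintro ⟨⟨y, hy⟩, hne⟩
    refine Subtype.ext (Subtype.ext ?_)
    simp only at hne ⊢
    obtain ⟨u, rfl⟩ : ∃ u, y = u + s • EuclideanSpace.single (0 : Fin d) (1 : ℝ) :=
      ⟨_, (sub_add_cancel _ _).symm⟩
    have hu : u ≠ 0 := by rintro rfl; simp at hne
    have h2 : 0 < ‖u‖ ^ 2 := by positivity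
    rw [add_sub_cancel_right, sub_add_cancel, norm_smul, mul_pow, smul_smul, Real.norm_eq_abs,
      sq_abs]
    congr 1
    have : -(s * ((-(s * (‖u‖ ^ 2)⁻¹)) ^ 2 * ‖u‖ ^ 2)⁻¹) * -(s * (‖u‖ ^ 2)⁻¹) = (1 : ℝ) := by
      have hs0 : s ≠ 0 := by rintro rfl; norm_num at hs
      field_simp
    rw [this, one_smul]
  right_inv := by
    rintro ⟨h, hh⟩
    refine Subtype.ext ?_
    simp only
    obtain ⟨k, rfl⟩ : ∃ k, h = k - (1 / 2 : ℝ) • EuclideanSpace.single (0 : Fin d) (1 : ℝ) :=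
      ⟨_, (add_sub_cancel_right _ _).symm⟩
    have hk : 1 / 2 ≤ k 0 := by simpa using hh
    have hk0 : k ≠ 0 := by rintro rfl; norm_num at hk
    have h2 : 0 < ‖k‖ ^ 2 := by positivity
    rw [sub_add_cancel, add_sub_cancel_right, norm_smul, mul_pow, smul_smul, Real.norm_eq_abs,
      sq_abs]
    congr 1
    have : -(s * ((-(s * (‖k‖ ^ 2)⁻¹)) ^ 2 * ‖k‖ ^ 2)⁻¹) * -(s * (‖k‖ ^ 2)⁻¹) = (1 : ℝ) := by
      have hs0 : s ≠ 0 := by rintro rfl; norm_num at hs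
      field_simp
    rw [this, one_smul]
  continuous_toFun := by
    refine Continuous.subtype_mk ?_ _
    refine Continuous.sub ?_ continuous_const
    refine Continuous.smul (f := fun y => (-(s * (‖_‖ ^ 2)⁻¹) : ℝ)) ?_ (by fun_prop)
    refine (continuous_const.mul (Continuous.inv₀ (by fun_prop) ?_)).neg
    rintro ⟨y, hne⟩
    have := norm_ne_zero_iff.2 (sub_ne_zero.2 hne)
    positivity
  continuous_invFun := by
    refine Continuous.subtype_mk (Continuous.subtype_mk ?_ _) _
    have hc : Continuous fun h : EuclideanHalfSpace d => h.1 := continuous_subtype_val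
    refine Continuous.add ?_ continuous_const
    refine Continuous.smul (f := fun y => (-(s * (‖_‖ ^ 2)⁻¹) : ℝ)) ?_ (by fun_prop)
    refine (continuous_const.mul (Continuous.inv₀ (by fun_prop) ?_)).neg
    rintro ⟨h, hh⟩
    have hk : (h + (1 / 2 : ℝ) • EuclideanSpace.single (0 : Fin d) (1 : ℝ)) ≠ 0 := by
      intro h2
      have := congrArg (fun x : EuclideanSpace ℝ (Fin d) => x 0) h2
      simp at this
      linarith
    positivity

/-- The chart of the closed unit ball given by inversion at `s • e₀`. -/
def ballChart (s : ℝ) (hs : s * s = 1) :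
    OpenPartialHomeomorph (closedBall (0 : EuclideanSpace ℝ (Fin d)) 1) (EuclideanHalfSpace d) :=
  (TopologicalSpace.Opens.openPartialHomeomorphSubtypeCoe
    (⟨{y | y.1 ≠ s • EuclideanSpace.single (0 : Fin d) (1 : ℝ)},
      isOpen_ne_fun continuous_subtype_val continuous_const⟩ :
      TopologicalSpace.Opens (closedBall (0 : EuclideanSpace ℝ (Fin d)) 1))
    ⟨(ballMinusPointHomeomorph s hs).symm default⟩).symm.trans
      (ballMinusPointHomeomorph s hs).toOpenPartialHomeomorph

theorem mem_ballChart_source (s : ℝ) (hs : s * s = 1)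
    (y : closedBall (0 : EuclideanSpace ℝ (Fin d)) 1)
    (hy : y.1 ≠ s • EuclideanSpace.single (0 : Fin d) (1 : ℝ)) : y ∈ (ballChart s hs).source := by
  simpa [ballChart] using hy

open Classical in
instance ballChartedSpace :
    ChartedSpace (EuclideanHalfSpace d) (closedBall (0 : EuclideanSpace ℝ (Fin d)) 1) where
  atlas := {ballChart 1 (by norm_num), ballChart (-1) (by norm_num)}
  chartAt y := if y.1 = (1 : ℝ) • EuclideanSpace.single (0 : Fin d) (1 : ℝ) then
    ballChart (-1) (by norm_num) else ballChart 1 (by norm_num)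
  mem_chart_source y := by
    split_ifs with h
    · refine mem_ballChart_source _ _ _ fun h' => ?_
      have := congrArg (fun x : EuclideanSpace ℝ (Fin d) => x 0) (h.symm.trans h')
      norm_num at this
    · exact mem_ballChart_source _ _ _ h
  chart_mem_atlas y := by
    split_ifs <;> simp

theorem nonempty_chartedSpace_of_homeomorph {H M N : Type*} [TopologicalSpace H]
    [TopologicalSpace M] [TopologicalSpace N] [ChartedSpace H N] (e : M ≃ₜ N) :
    Nonempty (ChartedSpace H M) :=
  ⟨{atlas := Set.range fun x : M => e.toOpenPartialHomeomorph.trans (chartAt H (e x))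
    chartAt := fun x => e.toOpenPartialHomeomorph.trans (chartAt H (e x))
    mem_chart_source := fun x => by simp
    chart_mem_atlas := fun x => ⟨x, rfl⟩}⟩

/-- A compact convex set with nonempty interior in `ℝ^d` is a manifold with boundary. -/
theorem nonempty_chartedSpace_convex {s : Set (Fin d → ℝ)} (hc : Convex ℝ s)
    (hne : (interior s).Nonempty) (hs : IsCompact s) :
    Nonempty (ChartedSpace (EuclideanHalfSpace d) s) := by
  let e := (EuclideanSpace.equiv (Fin d) ℝ).symm
  have hc' : Convex ℝ (e '' s) := hc.is_linear_image e.toLinearMap.isLinear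
  have hne' : (interior (e '' s)).Nonempty := by
    change (interior (e.toHomeomorph '' s)).Nonempty
    rw [← e.toHomeomorph.image_interior]
    exact hne.image _
  have hs' : IsCompact (e '' s) := hs.image e.continuous
  obtain ⟨h, -, hcl, -⟩ :=
    exists_homeomorph_image_interior_closure_frontier_eq_unitBall hc' hne' hs'.isBounded
  rw [hs'.isClosed.closure_eq] at hcl
  exact nonempty_chartedSpace_of_homeomorph
    ((e.toHomeomorph.image s).trans ((h.image (e '' s)).trans (Homeomorph.setCongr hcl)))

end CubicalLattice

end

noncomputable section

namespace CubicalLattice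

/-! ### Cubes -/

/-- The subcomplex of `ℤ^d` that decomposes the cube `[-n, n]^d`. -/
def cube (d n : ℕ) : Subcomplex d where
  cells := {σ | ∀ i, -(n : ℤ) ≤ σ.1 i ∧ σ.1 i + (if i ∈ σ.2 then 1 else 0) ≤ n}
  lower_mem σ hσ i hi j := by
    have := hσ j
    simp only [Cell.lower, Finset.mem_erase]
    by_cases hj : j ∈ σ.2 <;> simp only [hj, if_true, if_false, and_true, and_false] at this ⊢
    · split_ifs <;> omega
    · exact this
  upper_mem σ hσ i hi j := by
    have := hσ j
    simp only [Cell.upper, Finset.mem_erase, Pi.add_apply]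
    rcases eq_or_ne j i with rfl | hj
    · simp only [hi, if_true, Pi.single_eq_same, ne_eq, not_true_eq_false, false_and,
        if_false] at this ⊢
      omega
    · simpa [hj] using this

theorem cube_realization (d n : ℕ) :
    (cube d n).realization = Metric.closedBall (0 : Fin d → ℝ) n := by
  ext x
  rw [mem_closedBall_zero_iff, pi_norm_le_iff_of_nonneg (Nat.cast_nonneg n)]
  simp only [Real.norm_eq_abs, abs_le]
  constructor
  · rintro ⟨σ, hσ, hx⟩ i
    have h1 := hσ i
    have h2 := hx i
    have h3 : (-(n : ℝ)) ≤ σ.1 i := by exact_mod_cast h1.1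
    have h4 : (σ.1 i : ℝ) + (if i ∈ σ.2 then 1 else 0) ≤ n := by exact_mod_cast h1.2
    exact ⟨h3.trans h2.1, h2.2.trans h4⟩
  · intro hx
    refine ⟨(fun i => ⌊x i⌋, Finset.univ.filter fun i => (⌊x i⌋ : ℝ) ≠ x i), fun i => ?_,
      fun i => ?_⟩
    · have h1 : (-(n : ℤ)) ≤ ⌊x i⌋ := Int.le_floor.2 (by push_cast; exact (hx i).1)
      have h2 : ((⌊x i⌋ : ℤ) : ℝ) ≤ n := (Int.floor_le _).trans (hx i).2
      refine ⟨h1, ?_⟩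
      simp only [Finset.mem_filter, Finset.mem_univ, true_and]
      split_ifs with h
      · have h3 : ((⌊x i⌋ : ℤ) : ℝ) < n := (lt_of_le_of_ne (Int.floor_le _) h).trans_le (hx i).2
        have : (⌊x i⌋ : ℤ) < n := by exact_mod_cast h3
        omega
      · have : (⌊x i⌋ : ℤ) ≤ n := by exact_mod_cast h2
        omega
    · simp only [Finset.mem_filter, Finset.mem_univ, true_and]
      refine ⟨Int.floor_le _, ?_⟩
      split_ifs with h
      · exact (Int.lt_floor_add_one _).le
      · rw [not_not.1 h, add_zero]

theorem cube_finite (d n : ℕ) : (cube d n).cells.Finite := by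
  have h : (cube d n).cells ⊆
      (Set.univ.pi fun _ : Fin d => Set.Icc (-(n : ℤ)) n) ×ˢ (Set.univ : Set (Finset (Fin d))) := by
    intro σ hσ
    refine ⟨fun i _ => ⟨(hσ i).1, ?_⟩, trivial⟩
    have := (hσ i).2
    split_ifs at this <;> omega
  exact ((Set.Finite.pi fun _ => Set.finite_Icc _ _).prod Set.finite_univ).subset h

theorem cube_isAdmissible (d : ℕ) [NeZero d] {n : ℕ} (hn : n ≠ 0) : (cube d n).IsAdmissible where
  finite := cube_finite d n
  contractible := by
    rw [cube_realization]
    exact (convex_closedBall _ _).contractibleSpace ⟨0, by simp⟩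
  manifold := by
    rw [cube_realization]
    refine nonempty_chartedSpace_convex (convex_closedBall _ _) ⟨0, ?_⟩ (isCompact_closedBall _ _)
    exact Metric.ball_subset_interior_closedBall (Metric.mem_ball_self (by positivity))

/-- The cube `[-(n+1), n+1]^d` as an admissible subcomplex. -/
def admissibleCube (d : ℕ) [NeZero d] (n : ℕ) : Admissible d :=
  ⟨cube d (n + 1), cube_isAdmissible d n.succ_ne_zero⟩

theorem exists_mem_cube {d : ℕ} [NeZero d] (σ : Cell d) :
    ∃ N, ∀ n, N ≤ n → σ ∈ (admissibleCube d n).1.cells := by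
  refine ⟨∑ i, (σ.1 i).natAbs, fun n hn i => ?_⟩
  have h1 : (σ.1 i).natAbs ≤ ∑ i, (σ.1 i).natAbs :=
    Finset.single_le_sum (f := fun i => (σ.1 i).natAbs) (fun _ _ => Nat.zero_le _)
      (Finset.mem_univ i)
  constructor <;> (try split_ifs) <;> push_cast <;> omega

theorem exists_subset_cube {d : ℕ} [NeZero d] {s : Set (Cell d)} (hs : s.Finite) :
    ∃ N, ∀ n, N ≤ n → s ⊆ (admissibleCube d n).1.cells := by
  choose f hf using fun σ : Cell d => exists_mem_cube σ
  obtain ⟨N, hN⟩ := (hs.image f).bddAbove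
  exact ⟨N, fun n hn σ hσ => hf σ n ((hN (Set.mem_image_of_mem f hσ)).trans hn)⟩

end CubicalLattice

end

noncomputable section

namespace CubicalLattice

open Subcomplex

/-! ### Explicit formulas for the coboundary in low degrees -/

variable {d : ℕ}

/-- The vertex `v` of the lattice. -/
def vertex (v : Fin d → ℤ) : (lattice d).KCell 0 := ⟨(v, ∅), trivial, rfl⟩

/-- The edge of the lattice from `v` in direction `a`. -/
def edge (v : Fin d → ℤ) (a : Fin d) : (lattice d).KCell 1 :=
  ⟨(v, {a}), trivial, Finset.card_singleton a⟩

/-- The plaquette of the lattice with lowest vertex `v` in directions `a < b`. -/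
def plaquette (v : Fin d → ℤ) {a b : Fin d} (hab : a < b) : (lattice d).KCell 2 :=
  ⟨(v, {a, b}), trivial, Finset.card_pair hab.ne⟩

theorem exists_eq_edge (σ : (lattice d).KCell 1) : ∃ v a, σ = edge v a := by
  obtain ⟨a, ha⟩ := Finset.card_eq_one.1 σ.2.2
  exact ⟨σ.1.1, a, Subtype.ext (Prod.ext rfl ha)⟩

theorem exists_eq_plaquette (σ : (lattice d).KCell 2) :
    ∃ (v : Fin d → ℤ) (a b : Fin d) (h : a < b), σ = plaquette v h := by
  obtain ⟨a, b, hne, h⟩ := Finset.card_eq_two.1 σ.2.2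
  rcases lt_or_gt_of_ne hne with h' | h'
  · exact ⟨σ.1.1, a, b, h', Subtype.ext (Prod.ext rfl h)⟩
  · exact ⟨σ.1.1, b, a, h', Subtype.ext (Prod.ext rfl (h.trans (Finset.pair_comm a b)))⟩

theorem mulCoboundary_edge {A : Type} [CommGroup A] (c : (lattice d).KCell 0 → A)
    (v : Fin d → ℤ) (a : Fin d) :
    (lattice d).mulCoboundary 0 A c (edge v a) =
      c (vertex (v + Pi.single a 1)) / c (vertex v) := by
  change (∏ i : {i // i ∈ ({a} : Finset (Fin d))}, _) = _
  rw [Fintype.prod_eq_single (⟨a, by simp⟩ : {i // i ∈ ({a} : Finset (Fin d))})]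
  · have h1 : (lattice d).upperFace (edge v a) ⟨a, by simp [edge]⟩ =
        vertex (v + Pi.single a 1) :=
      Subtype.ext (Prod.ext rfl (Finset.erase_singleton a))
    have h2 : (lattice d).lowerFace (edge v a) ⟨a, by simp [edge]⟩ = vertex v :=
      Subtype.ext (Prod.ext rfl (Finset.erase_singleton a))
    have h3 : (lattice d).incidence (edge v a) ⟨a, by simp [edge]⟩ = 1 := by
      simp [incidence, edge, Finset.filter_singleton]
    rw [h1, h2, h3, zpow_one]
  · rintro ⟨i, hi⟩ hne
    exact absurd (Subtype.ext (Finset.mem_singleton.1 hi)) hne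

@[to_additive]
theorem mulCoboundary_plaquette {A : Type} [CommGroup A] (c : (lattice d).KCell 1 → A)
    (v : Fin d → ℤ) {a b : Fin d} (hab : a < b) :
    (lattice d).mulCoboundary 1 A c (plaquette v hab) =
      (c (edge (v + Pi.single a 1) b) / c (edge v b)) /
        (c (edge (v + Pi.single b 1) a) / c (edge v a)) := by
  have ha : a ∈ (plaquette v hab).1.2 := by simp [plaquette]
  have hb : b ∈ (plaquette v hab).1.2 := by simp [plaquette]
  have hne : a ≠ b := hab.ne
  have hea : ({a, b} : Finset (Fin d)).erase a = {b} := by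
    ext i; simp; grind
  have heb : ({a, b} : Finset (Fin d)).erase b = {a} := by
    ext i; simp; grind
  have key : ∀ f : {i // i ∈ ({a, b} : Finset (Fin d))} → A,
      ∏ i, f i = f ⟨a, by simp⟩ * f ⟨b, by simp⟩ := by
    intro f
    refine Fintype.prod_eq_mul _ _ (fun h => hne (congrArg Subtype.val h)) ?_
    rintro ⟨i, hi⟩ ⟨h2, h3⟩
    rcases Finset.mem_insert.1 hi with h | h
    · exact absurd (Subtype.ext h) h2
    · exact absurd (Subtype.ext (Finset.mem_singleton.1 h)) h3
  have hprod : (lattice d).mulCoboundary 1 A c (plaquette v hab) =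
      (c ((lattice d).upperFace (plaquette v hab) ⟨a, ha⟩) /
        c ((lattice d).lowerFace (plaquette v hab) ⟨a, ha⟩)) ^
          (lattice d).incidence (plaquette v hab) ⟨a, ha⟩ *
      (c ((lattice d).upperFace (plaquette v hab) ⟨b, hb⟩) /
        c ((lattice d).lowerFace (plaquette v hab) ⟨b, hb⟩)) ^
          (lattice d).incidence (plaquette v hab) ⟨b, hb⟩ := key _
  have ia : (lattice d).incidence (plaquette v hab) ⟨a, ha⟩ = 1 := by
    simp only [incidence, plaquette]
    rw [Finset.filter_eq_empty_iff.2]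
    · simp
    · intro x hx
      simp at hx
      rcases hx with rfl | rfl
      · simp
      · exact not_lt.2 hab.le
  have ib : (lattice d).incidence (plaquette v hab) ⟨b, hb⟩ = -1 := by
    simp only [incidence, plaquette]
    rw [show ({a, b} : Finset (Fin d)).filter (fun j => j < b) = {a} by ext i; simp; grind]
    simp
  have h1 : (lattice d).upperFace (plaquette v hab) ⟨a, ha⟩ = edge (v + Pi.single a 1) b :=
    Subtype.ext (Prod.ext rfl hea)
  have h2 : (lattice d).lowerFace (plaquette v hab) ⟨a, ha⟩ = edge v b :=
    Subtype.ext (Prod.ext rfl hea)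
  have h3 : (lattice d).upperFace (plaquette v hab) ⟨b, hb⟩ = edge (v + Pi.single b 1) a :=
    Subtype.ext (Prod.ext rfl heb)
  have h4 : (lattice d).lowerFace (plaquette v hab) ⟨b, hb⟩ = edge v a :=
    Subtype.ext (Prod.ext rfl heb)
  rw [hprod, ia, ib, h1, h2, h3, h4, zpow_one, zpow_neg, zpow_one, ← div_eq_mul_inv]

/-! ### The Poincaré lemma in degree one -/

/-- A discrete primitive of a function on `ℤ` with values in an Abelian group. -/
def antidifference {A : Type} [CommGroup A] (f : ℤ → A) (n : ℤ) : A :=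
  (∏ i ∈ Finset.Ico 0 n, f i) / ∏ i ∈ Finset.Ico n 0, f i

theorem antidifference_succ {A : Type} [CommGroup A] (f : ℤ → A) (n : ℤ) :
    antidifference f (n + 1) = antidifference f n * f n := by
  unfold antidifference
  rcases le_or_gt 0 n with h | h
  · rw [Finset.Ico_eq_empty_of_le h, Finset.Ico_eq_empty_of_le (by omega : (0 : ℤ) ≤ n + 1),
      ← Finset.insert_Ico_right_eq_Ico_add_one h, Finset.prod_insert (by simp)]
    simp [mul_comm]
  · rw [Finset.Ico_eq_empty_of_le h.le, Finset.Ico_eq_empty_of_le (by omega : n + 1 ≤ (0 : ℤ)),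
      ← Finset.insert_Ico_add_one_left_eq_Ico h, Finset.prod_insert (by simp)]
    simp [mul_comm]

/-- A flat `1`-cochain that vanishes in a set of directions can be gauge fixed to vanish in one more
direction. -/
theorem exists_gauge_step {A : Type} [CommGroup A] (x : (Fin d → ℤ) → Fin d → A)
    (hx : ∀ v a b, x (v + Pi.single a 1) b / x v b = x (v + Pi.single b 1) a / x v a)
    (s : Set (Fin d)) (k : Fin d) (hs : ∀ a ∈ s, ∀ v, x v a = 1) (hk : k ∉ s) :
    ∃ c : (Fin d → ℤ) → A,
      ∀ a, a = k ∨ a ∈ s → ∀ v, c (v + Pi.single a 1) / c v = x v a := by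
  refine ⟨fun v => antidifference (fun n => x (Function.update v k n) k) (v k), fun a ha v => ?_⟩
  rcases ha with rfl | ha
  · have h1 : ∀ n, Function.update (v + Pi.single a 1) a n = Function.update v a n := by
      intro n
      ext j
      rcases eq_or_ne j a with rfl | hj <;> simp [*]
    simp only [h1, Pi.add_apply, Pi.single_eq_same]
    rw [antidifference_succ, mul_div_cancel_left, Function.update_eq_self]
  · have hak : a ≠ k := fun h => hk (h ▸ ha)
    have h1 : ∀ n, Function.update (v + Pi.single a 1) k n =
        Function.update v k n + Pi.single a 1 := by
      intro n
      ext j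
      rcases eq_or_ne j k with rfl | hj
      · simp [hak.symm]
      · simp [hj]
    have h2 : ∀ w, x (w + Pi.single a 1) k = x w k := by
      intro w
      have := hx w a k
      rw [hs a ha, hs a ha, div_one] at this
      exact div_eq_one.1 this
    simp only [h1, h2, Pi.add_apply, Pi.single_eq_of_ne hak.symm, add_zero, div_self']
    exact (hs a ha v).symm

theorem exists_gauge {A : Type} [CommGroup A] (x : (Fin d → ℤ) → Fin d → A)
    (hx : ∀ v a b, x (v + Pi.single a 1) b / x v b = x (v + Pi.single b 1) a / x v a)
    (s : Finset (Fin d)) :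
    ∃ c : (Fin d → ℤ) → A, ∀ a ∈ s, ∀ v, c (v + Pi.single a 1) / c v = x v a := by
  induction s using Finset.induction_on with
  | empty => exact ⟨1, by simp⟩
  | insert k s hk ih =>
    obtain ⟨c, hc⟩ := ih
    obtain ⟨c', hc'⟩ := exists_gauge_step (fun v a => x v a / (c (v + Pi.single a 1) / c v))
      (by
        intro v a b
        have := hx v a b
        rw [add_right_comm v (Pi.single a 1) (Pi.single b 1)]
        rw [div_div_div_comm, this, div_div_div_comm (x (v + Pi.single b 1) a)
          (c (v + Pi.single b 1 + Pi.single a 1) / c (v + Pi.single b 1))]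
        congr 1
        rw [div_div_div_comm])
      (s : Set (Fin d)) k (fun a ha v => by rw [hc a ha, div_self']) hk
    refine ⟨fun v => c v * c' v, fun a ha v => ?_⟩
    have h := hc' a (by simpa using ha) v
    rw [mul_div_mul_comm, h, mul_div_cancel]

theorem exists_eq_mulCoboundary_zero {A : Type} [CommGroup A] (x : (lattice d).KCell 1 → A)
    (hx : (lattice d).mulCoboundary 1 A x = 1) :
    ∃ c, (lattice d).mulCoboundary 0 A c = x := by
  have flat : ∀ (v : Fin d → ℤ) (a b : Fin d), a < b →
      x (edge (v + Pi.single a 1) b) / x (edge v b) =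
        x (edge (v + Pi.single b 1) a) / x (edge v a) := by
    intro v a b hab
    have := congrFun hx (plaquette v hab)
    rw [mulCoboundary_plaquette] at this
    exact div_eq_one.1 this
  obtain ⟨c, hc⟩ := exists_gauge (fun v a => x (edge v a)) (by
    intro v a b
    rcases lt_trichotomy a b with h | rfl | h
    · exact flat v a b h
    · rfl
    · exact (flat v b a h).symm) Finset.univ
  refine ⟨fun σ => c σ.1.1, funext fun σ => ?_⟩
  obtain ⟨v, a, rfl⟩ := exists_eq_edge σ
  rw [mulCoboundary_edge]
  exact hc a (Finset.mem_univ a) v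

/-! ### Restriction and extension of cochains -/

open Classical in
/-- Extension of a cochain on `K` to the lattice by the neutral element. -/
@[to_additive]
def mulExtend (K : Subcomplex d) {k : ℕ} {A : Type} [CommGroup A] (c : K.KCell k → A)
    (σ : (lattice d).KCell k) : A :=
  if h : σ.1 ∈ K.cells then c ⟨σ.1, h, σ.2.2⟩ else 1

@[to_additive]
theorem mulExtend_incl (K : Subcomplex d) {k : ℕ} {A : Type} [CommGroup A] (c : K.KCell k → A)
    (σ : K.KCell k) : mulExtend K c (K.incl k σ) = c σ := by
  have h : (K.incl k σ).1 ∈ K.cells := σ.2.1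
  rw [mulExtend, dif_pos h]
  rfl

@[to_additive]
theorem mulCoboundary_mulExtend (K : Subcomplex d) {k : ℕ} {A : Type} [CommGroup A]
    (c : K.KCell k → A) (σ : K.KCell (k + 1)) :
    (lattice d).mulCoboundary k A (mulExtend K c) (K.incl (k + 1) σ) = K.mulCoboundary k A c σ := by
  have : (fun τ => mulExtend K c (K.incl k τ)) = c := funext (mulExtend_incl K c)
  conv_rhs => rw [← this]
  rfl

end CubicalLattice

end

noncomputable section

namespace CubicalLattice

open Subcomplex MeasureTheory Filter Topology

/-! ### Gauge orbits and the limit group -/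

variable {d : ℕ}

theorem continuous_mulCoboundary (K : Subcomplex d) (k : ℕ) :
    Continuous (K.mulCoboundary k Circle) := by
  refine continuous_pi fun σ => ?_
  change Continuous fun c : K.KCell k → Circle => ∏ i : {i // i ∈ σ.1.2},
    (c (K.upperFace σ i) / c (K.lowerFace σ i)) ^ K.incidence σ i
  refine continuous_finsetProd _ fun i _ => Continuous.zpow ?_ _
  exact (continuous_apply (K.upperFace σ i)).div' (continuous_apply (K.lowerFace σ i))

theorem isClosed_range_mulCoboundary (K : Subcomplex d) (k : ℕ) :
    IsClosed ((K.mulCoboundary k Circle).range : Set (K.KCell (k + 1) → Circle)) := by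
  rw [MonoidHom.coe_range]
  exact (isCompact_range (continuous_mulCoboundary K k)).isClosed

theorem exists_extension_of_mem_imGroup (K : Subcomplex d) {x : K.KCell 2 → Circle}
    (hx : x ∈ K.imGroup) : ∃ c : (lattice d).KCell 1 → Circle,
      K.restrictGroup 2 ((lattice d).mulCoboundary 1 Circle c) = x := by
  obtain ⟨c, rfl⟩ := hx
  exact ⟨mulExtend K c, funext fun σ => mulCoboundary_mulExtend K c σ⟩

variable [NeZero d]

theorem isClosed_limitGroup : IsClosed (limitGroup d : Set ((lattice d).KCell 2 → Circle)) := by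
  rw [limitGroup, Subgroup.coe_iInf]
  exact isClosed_iInter fun K =>
    (isClosed_range_mulCoboundary K.1 1).preimage (K.1.restrictGroup 2).continuous_toFun

instance : CompactSpace (limitGroup d) := isCompact_iff_compactSpace.1 isClosed_limitGroup.isCompact

theorem limitGroup_eq_range : limitGroup d = ((lattice d).mulCoboundary 1 Circle).range := by
  refine le_antisymm (fun x hx => ?_) ?_
  · choose c hc using fun n : ℕ => exists_extension_of_mem_imGroup (admissibleCube d n).1
      (restrictGroup_mem (admissibleCube d n) ⟨x, hx⟩)
    refine (isClosed_range_mulCoboundary (lattice d) 1).mem_of_tendsto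
      (f := fun n => (lattice d).mulCoboundary 1 Circle (c n)) (b := atTop) ?_
      (Eventually.of_forall fun n => ⟨c n, rfl⟩)
    refine tendsto_pi_nhds.2 fun σ => ?_
    obtain ⟨N, hN⟩ := exists_mem_cube σ.1
    refine tendsto_const_nhds.congr' ?_
    filter_upwards [eventually_ge_atTop N] with n hn
    exact (congrFun (hc n) ⟨σ.1, hN n hn, σ.2.2⟩).symm
  · rintro _ ⟨c, rfl⟩
    exact coboundary_mem_limitGroup c

theorem dBar_bijective : Function.Bijective (dBar d) := by
  constructor
  · rw [← MonoidHom.ker_eq_bot_iff, eq_bot_iff]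
    intro x
    induction x using QuotientGroup.induction_on with
    | H c =>
      intro hc
      have hc' : (lattice d).mulCoboundary 1 Circle c = 1 := congrArg Subtype.val hc
      exact (QuotientGroup.eq_one_iff c).2 (exists_eq_mulCoboundary_zero c hc')
  · rintro ⟨x, hx⟩
    obtain ⟨c, rfl⟩ := limitGroup_eq_range.le hx
    exact ⟨(c : GaugeOrbits d), rfl⟩

theorem continuous_dBar : Continuous (dBar d) := by
  refine continuous_quot_lift _ ?_
  exact (continuous_mulCoboundary (lattice d) 1).subtype_mk _

/-- The homeomorphism from gauge orbits to the limit group induced by `d_1`. -/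
def dBarHomeomorph (d : ℕ) [NeZero d] : GaugeOrbits d ≃ₜ limitGroup d :=
  Continuous.homeoOfEquivCompactToT2 (f := Equiv.ofBijective (dBar d) dBar_bijective)
    continuous_dBar

theorem invFun_dBar : Function.invFun (dBar d) = (dBarHomeomorph d).symm := by
  funext y
  refine (dBarHomeomorph d).injective ?_
  rw [Homeomorph.apply_symm_apply]
  exact Function.rightInverse_invFun dBar_bijective.2 y

theorem wilsonBar_dBarHomeomorph_symm (p : (lattice d).KCell 2) (y : limitGroup d) :
    wilsonBar p ((dBarHomeomorph d).symm y) = y.1 p := by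
  obtain ⟨x, rfl⟩ := (dBarHomeomorph d).surjective y
  rw [Homeomorph.symm_apply_apply]
  induction x using QuotientGroup.induction_on with
  | H c => rfl

theorem integral_gaugeMeasure (β : ℝ) (f : GaugeOrbits d → ℂ) :
    ∫ x, f x ∂(gaugeMeasure d β) =
      ∫ y, f ((dBarHomeomorph d).symm y) ∂(heatKernelMeasure (limitJ (d := d)) β) := by
  rw [gaugeMeasure, invFun_dBar]
  exact (dBarHomeomorph d).symm.isClosedEmbedding.integral_map f

end CubicalLattice

end

noncomputable section

namespace CubicalLattice

open Subcomplex MeasureTheory Filter Topology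

/-! ### Differentials of characters -/

/-- A continuous character of a real topological vector space is the exponential of a continuous
linear functional. -/
theorem exists_strongDual_of_character {E : Type} [NormedAddCommGroup E] [NormedSpace ℝ E]
    (χ : E → Circle) (hc : Continuous χ) (hadd : ∀ x y, χ (x + y) = χ x * χ y) :
    ∃ l : StrongDual ℝ E, ∀ x, χ x = Circle.exp (2 * Real.pi * l x) := by
  have h0 : χ 0 = 1 := by simpa using hadd 0 0
  obtain ⟨F, ⟨hF0, hF⟩, -⟩ := Circle.isCoveringMap_exp.existsUnique_continuousMap_lifts
    (⟨χ, hc⟩ : C(E, Circle)) 0 0 (by simp [h0])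
  have hF' : ∀ x, Circle.exp (F x) = χ x := fun x => congrFun hF x
  have hsub : (fun z : E × E => F (z.1 + z.2) - F z.1 - F z.2) = fun _ => 0 := by
    refine Circle.isCoveringMap_exp.eq_of_comp_eq (by fun_prop) (by fun_prop) ?_ (0, 0) (by
      simp [hF0])
    funext z
    simp [Circle.exp_sub, hF', hadd]
  let f : E →+ ℝ :=
    { toFun := F
      map_zero' := hF0
      map_add' := fun x y => by
        have := congrFun hsub (x, y)
        simp only at this
        linarith }
  refine ⟨(2 * Real.pi)⁻¹ • f.toRealLinearMap F.continuous, fun x => ?_⟩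
  rw [← hF' x]
  congr 1
  have : (2 * Real.pi) ≠ 0 := by positivity
  change F x = 2 * Real.pi * ((2 * Real.pi)⁻¹ * F x)
  rw [mul_inv_cancel_left₀ this]

variable {d : ℕ}

theorem continuous_apply_l2Cochain (K : Subcomplex d) {k : ℕ} (σ : K.KCell k) :
    Continuous fun x : K.L2Cochain k => x σ :=
  ((continuous_apply σ).comp lp.uniformContinuous_coe.continuous)

theorem continuous_expMap (K : Subcomplex d) : Continuous K.expMap := by
  refine Continuous.subtype_mk (continuous_pi fun σ => ?_) _
  exact Circle.exp.continuous.comp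
    (continuous_const.mul ((continuous_apply_l2Cochain K σ).comp continuous_subtype_val))

theorem expMap_add (K : Subcomplex d) (X Y : K.imLie) :
    K.expMap (X + Y) = K.expMap X * K.expMap Y := by
  refine Subtype.ext (funext fun σ => ?_)
  change Circle.exp (2 * Real.pi * ((X : K.L2Cochain 2) σ + (Y : K.L2Cochain 2) σ)) =
    Circle.exp _ * Circle.exp _
  rw [mul_add, Circle.exp_add]

theorem charDifferential_spec (K : Subcomplex d) (χ : PontryaginDual K.imGroup) (X : K.imLie) :
    χ (K.expMap X) = Circle.exp (2 * Real.pi * charDifferential K χ X) :=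
  Classical.epsilon_spec (p := fun l : StrongDual ℝ K.imLie =>
    ∀ X : K.imLie, χ (K.expMap X) = Circle.exp (2 * Real.pi * l X))
    (exists_strongDual_of_character _ ((map_continuous χ).comp (continuous_expMap K))
      fun X Y => by simp [expMap_add]) X

/-! ### Characters of the limit group -/

variable [NeZero d]

theorem groupProj_surjective (K : Admissible d) : Function.Surjective (groupProj K) := by
  rintro ⟨x, hx⟩
  obtain ⟨c, hc⟩ := exists_extension_of_mem_imGroup K.1 hx
  exact ⟨⟨_, coboundary_mem_limitGroup c⟩, Subtype.ext hc⟩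

theorem exists_finite_support (χ : PontryaginDual (limitGroup d)) :
    ∃ s : Finset ((lattice d).KCell 2), ∀ x : limitGroup d, (∀ p ∈ s, x.1 p = 1) → χ x = 1 := by
  have hV : IsOpen (χ ⁻¹' Circle.centeredArc (Real.pi / 2)) :=
    (Circle.isOpen_centeredArc _).preimage (map_continuous χ)
  obtain ⟨U, hU, hUV⟩ := isOpen_induced_iff.1 hV
  have h1 : (1 : (lattice d).KCell 2 → Circle) ∈ U := by
    have : (1 : limitGroup d) ∈ Subtype.val ⁻¹' U := by
      rw [hUV, Set.mem_preimage, map_one]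
      exact ⟨0, by simp [Real.pi_pos], Circle.exp_zero⟩
    exact this
  obtain ⟨s, u, hu, hsub⟩ := isOpen_pi_iff.1 hU _ h1
  refine ⟨s, fun x hx => Circle.eq_one_of_forall_pow_mem_centeredArc_pi_div_two fun n hn => ?_⟩
  have : x ^ n ∈ Subtype.val ⁻¹' U := by
    refine hsub fun p hp => ?_
    have h2 : (x ^ n : limitGroup d).1 p = 1 := by
      change (x.1 p) ^ n = 1
      rw [hx p hp, one_pow]
    rw [h2]
    exact (hu p hp).2
  rw [hUV] at this
  simpa using this

theorem exists_eq_map_groupProj (χ : PontryaginDual (limitGroup d)) :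
    ∃ (K : Admissible d) (ψ : PontryaginDual K.1.imGroup),
      χ = PontryaginDual.map (groupProj K) ψ := by
  obtain ⟨s, hs⟩ := exists_finite_support χ
  obtain ⟨N, hN⟩ := exists_subset_cube (s.finite_toSet.image Subtype.val)
  let K := admissibleCube d N
  have hker : (groupProj K).toMonoidHom.ker ≤ (χ : limitGroup d →* Circle).ker := by
    intro x hx
    refine hs x fun p hp => ?_
    have h1 := hN N le_rfl (Set.mem_image_of_mem Subtype.val hp)
    exact congrFun (congrArg Subtype.val hx) (⟨p.1, h1, p.2.2⟩ : K.1.KCell 2)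
  have hq : IsQuotientMap (groupProj K) :=
    (map_continuous (groupProj K)).isClosedMap.isQuotientMap (map_continuous _)
      (groupProj_surjective K)
  let g := (groupProj K).toMonoidHom.liftOfSurjective (groupProj_surjective K)
    ⟨(χ : limitGroup d →* Circle), hker⟩
  have hg : ∀ x, g (groupProj K x) = χ x := fun x =>
    MonoidHom.liftOfRightInverse_comp_apply _ _ _ _ x
  have hgc : Continuous g := by
    refine hq.continuous_iff.2 ?_
    convert map_continuous χ using 1
    exact funext hg
  refine ⟨K, (⟨g, hgc⟩ : K.1.imGroup →ₜ* Circle), ?_⟩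
  ext1 x
  exact (hg x).symm

/-- The exponential map from the limit Hilbert space to the limit group. -/
def limitExp (X : limitHilbert d) : limitGroup d :=
  ⟨fun p => Circle.exp (2 * Real.pi * X.1 p),
    Subgroup.mem_iInf.2 fun K => (K.1.expMap (hilbertProj K X)).2⟩

theorem limitJ_spec (χ : PontryaginDual (limitGroup d)) (X : limitHilbert d) :
    χ (limitExp X) = Circle.exp (2 * Real.pi * limitJ χ X) := by
  obtain ⟨K, ψ, hχ, hl⟩ := Classical.epsilon_spec
    (p := fun l : StrongDual ℝ (limitHilbert d) =>
      ∃ (K : Admissible d) (ψ : PontryaginDual K.1.imGroup),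
        χ = PontryaginDual.map (groupProj K) ψ ∧
        l = (charDifferential K.1 ψ).comp (hilbertProj K))
    (by
      obtain ⟨K, ψ, h⟩ := exists_eq_map_groupProj χ
      exact ⟨_, K, ψ, h, rfl⟩)
  have hJ : limitJ χ = (charDifferential K.1 ψ).comp (hilbertProj K) := hl
  rw [hJ, ContinuousLinearMap.comp_apply, ← charDifferential_spec]
  nth_rewrite 1 [hχ]
  rfl

theorem continuous_limitExp : Continuous (limitExp (d := d)) := by
  refine Continuous.subtype_mk (continuous_pi fun p => ?_) _
  exact Circle.exp.continuous.comp
    (continuous_const.mul ((continuous_apply_l2Cochain _ p).comp continuous_subtype_val))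

/-- A continuous linear functional is determined by its exponential. -/
theorem strongDual_ext_of_exp {E : Type} [NormedAddCommGroup E] [NormedSpace ℝ E]
    {l m : StrongDual ℝ E}
    (h : ∀ x, Circle.exp (2 * Real.pi * l x) = Circle.exp (2 * Real.pi * m x)) : l = m := by
  have h1 : (fun x => 2 * Real.pi * l x) = fun x => 2 * Real.pi * m x :=
    Circle.isCoveringMap_exp.eq_of_comp_eq (by fun_prop) (by fun_prop) (funext h) 0 (by simp)
  ext x
  exact mul_left_cancel₀ (by positivity) (congrFun h1 x)

end CubicalLattice

end

noncomputable section

namespace CubicalLattice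

open Subcomplex MeasureTheory Filter Topology ProbabilityTheory

/-! ### Existence of heat kernel measures -/

section existence

variable {G H : Type} [CommGroup G] [TopologicalSpace G] [MeasurableSpace G] [BorelSpace G]
  [NormedAddCommGroup H] [InnerProductSpace ℝ H]
  {J : PontryaginDual G → StrongDual ℝ H} {e : H → G}

/-- The image in `G` of the centred Gaussian measure of variance `2β` on the span of a finite
family of vectors of `H`. -/
def gaussianImage {ι : Type} [Fintype ι] (e : H → G) (he : Continuous e) (β : ℝ) (b : ι → H) :
    ProbabilityMeasure G :=
  ⟨(stdGaussian (EuclideanSpace ℝ ι)).map fun t => e (√(2 * β) • ∑ i, t i • b i),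
    Measure.isProbabilityMeasure_map (Continuous.measurable (by fun_prop)).aemeasurable⟩

theorem integral_gaussianImage {ι : Type} [Fintype ι] (he : Continuous e) {β : ℝ} (hβ : 0 ≤ β)
    (b : ι → H) (hJ : ∀ χ X, χ (e X) = Circle.exp (2 * Real.pi * J χ X)) (χ : PontryaginDual G) :
    ∫ x, (starRingEnd ℂ) (χ x : ℂ) ∂(gaussianImage e he β b : Measure G) =
      ((Real.exp (-4 * Real.pi ^ 2 * β * ∑ i, J χ (b i) ^ 2) : ℝ) : ℂ) := by
  have hχ : Continuous fun x : G => (starRingEnd ℂ) (χ x : ℂ) :=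
    Complex.continuous_conj.comp (continuous_subtype_val.comp (map_continuous χ))
  let T : EuclideanSpace ℝ ι := WithLp.toLp 2 fun i => -(2 * Real.pi * √(2 * β)) * J χ (b i)
  have hint : ∀ t : EuclideanSpace ℝ ι,
      (starRingEnd ℂ) (χ (e (√(2 * β) • ∑ i, t i • b i)) : ℂ) =
        Complex.exp (inner ℝ t T * Complex.I) := by
    intro t
    rw [hJ, Circle.coe_exp, ← Complex.exp_conj]
    congr 1
    rw [map_mul, Complex.conj_I, Complex.conj_ofReal, mul_neg, ← neg_mul, ← Complex.ofReal_neg]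
    congr 2
    rw [map_smul, map_sum, smul_eq_mul, PiLp.inner_apply]
    simp only [map_smul, smul_eq_mul, T, RCLike.inner_apply, conj_trivial]
    rw [Finset.mul_sum, Finset.mul_sum, ← Finset.sum_neg_distrib]
    exact Finset.sum_congr rfl fun i _ => by ring
  have hT : ‖T‖ ^ 2 = 8 * Real.pi ^ 2 * β * ∑ i, J χ (b i) ^ 2 := by
    rw [EuclideanSpace.real_norm_sq_eq, Finset.mul_sum]
    refine Finset.sum_congr rfl fun i _ => ?_
    simp only [T]
    rw [mul_pow, neg_sq, mul_pow, Real.sq_sqrt (by positivity)]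
    ring
  change ∫ x, _ ∂((stdGaussian (EuclideanSpace ℝ ι)).map _) = _
  rw [integral_map (Continuous.measurable (by fun_prop)).aemeasurable
    hχ.aestronglyMeasurable]
  simp only [hint]
  rw [← charFun_apply, charFun_stdGaussian, ← Complex.ofReal_pow, hT]
  push_cast
  congr 1
  ring

theorem hasSum_sq_apply_hilbertBasis {ι : Type} [CompleteSpace H] (b : HilbertBasis ι ℝ H)
    (l : StrongDual ℝ H) : HasSum (fun i => l (b i) ^ 2) (‖l‖ ^ 2) := by
  obtain ⟨y, rfl⟩ := (InnerProductSpace.toDual ℝ H).surjective l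
  have h := b.hasSum_inner_mul_inner y y
  rw [real_inner_self_eq_norm_sq] at h
  simp only [LinearIsometryEquiv.norm_map, InnerProductSpace.toDual_apply_apply]
  have h1 : (fun i => inner ℝ y (b i) ^ 2) = fun i => inner ℝ y (b i) * inner ℝ (b i) y :=
    funext fun i => by rw [pow_two, real_inner_comm y (b i)]
  rwa [h1]

/-- If `J` is the dual of a continuous map `e : H → G`, a heat kernel measure exists. -/
theorem exists_isHeatKernelMeasure [CompactSpace G] [T2Space G] [CompleteSpace H]
    (he : Continuous e) {β : ℝ} (hβ : 0 ≤ β)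
    (hJ : ∀ χ X, χ (e X) = Circle.exp (2 * Real.pi * J χ X)) :
    ∃ μ : Measure G, IsHeatKernelMeasure J β μ := by
  obtain ⟨w, b, -⟩ := exists_hilbertBasis ℝ H
  let ν : Finset w → ProbabilityMeasure G := fun s => gaussianImage e he β fun i : s => b i
  let F : Ultrafilter (Finset w) := Ultrafilter.of atTop
  have hF : (F : Filter (Finset w)) ≤ atTop := Ultrafilter.of_le atTop
  obtain ⟨μ, hμ⟩ : ∃ μ, Tendsto ν F (𝓝 μ) := ⟨_, (F.map ν).le_nhds_lim⟩
  refine ⟨μ, inferInstance, fun χ => ?_⟩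
  have hχ : Continuous fun x : G => (starRingEnd ℂ) (χ x : ℂ) :=
    Complex.continuous_conj.comp (continuous_subtype_val.comp (map_continuous χ))
  have h1 := (ProbabilityMeasure.tendsto_iff_forall_integral_rclike_tendsto ℂ).1 hμ
    (BoundedContinuousFunction.mkOfCompact ⟨_, hχ⟩)
  refine tendsto_nhds_unique h1 ?_
  have h2 : Tendsto (fun s : Finset w => ∑ i : s, J χ (b i) ^ 2) atTop (𝓝 (‖J χ‖ ^ 2)) := by
    have h3 : Tendsto (fun s : Finset w => ∑ i ∈ s, J χ (b i) ^ 2) atTop (𝓝 (‖J χ‖ ^ 2)) :=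
      hasSum_sq_apply_hilbertBasis b (J χ)
    refine h3.congr fun s => ?_
    exact (Finset.sum_coe_sort s fun i => J χ (b i) ^ 2).symm
  have h4 : Tendsto (fun s : Finset w => ((Real.exp (-4 * Real.pi ^ 2 * β *
      ∑ i : s, J χ (b i) ^ 2) : ℝ) : ℂ)) F
      (𝓝 ((Real.exp (-4 * Real.pi ^ 2 * β * ‖J χ‖ ^ 2) : ℝ) : ℂ)) :=
    ((Complex.continuous_ofReal.comp (Real.continuous_exp.comp
      (continuous_const.mul continuous_id))).tendsto _).comp (h2.mono_left hF)
  exact h4.congr fun s => (integral_gaussianImage he hβ _ hJ χ).symm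

end existence

variable {d : ℕ} [NeZero d]

theorem finiteDimensional_l2Cochain (K : Admissible d) (k : ℕ) :
    FiniteDimensional ℝ (K.1.L2Cochain k) := by
  have : Finite (K.1.KCell k) := by
    have := K.2.finite.to_subtype
    exact Finite.of_injective (fun σ : K.1.KCell k => (⟨σ.1, σ.2.1⟩ : K.1.cells))
      fun σ τ h => Subtype.ext (congrArg (fun c : K.1.cells => c.1) h)
  exact Module.Finite.of_injective
    ({ toFun := fun x => x
       map_add' := fun _ _ => rfl
       map_smul' := fun _ _ => rfl } : K.1.L2Cochain k →ₗ[ℝ] (K.1.KCell k → ℝ))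
    fun x y h => Subtype.ext h

theorem isClosed_limitHilbert : IsClosed (limitHilbert d : Set ((lattice d).L2Cochain 2)) := by
  rw [limitHilbert, Submodule.coe_iInf]
  refine isClosed_iInter fun K => ?_
  have := finiteDimensional_l2Cochain K 2
  exact (K.1.imLie.closed_of_finiteDimensional).preimage (K.1.restrictL2 2).continuous

instance : CompleteSpace (limitHilbert d) := isClosed_limitHilbert.completeSpace_coe

theorem isHeatKernelMeasure_heatKernelMeasure {β : ℝ} (hβ : 0 ≤ β) :
    IsHeatKernelMeasure (limitJ (d := d)) β (heatKernelMeasure (limitJ (d := d)) β) :=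
  Classical.epsilon_spec (exists_isHeatKernelMeasure continuous_limitExp hβ limitJ_spec)

end CubicalLattice

end

noncomputable section

namespace CubicalLattice

open Subcomplex

/-! ### The limit Hilbert space is the closure of the image of `d_1` -/

variable {d : ℕ}

/-- The component of a `2`-cochain at the plaquette in directions `a, b` with lowest vertex `v`,
extended to be antisymmetric in `a` and `b`. -/
def component (x : (lattice d).KCell 2 → ℝ) (v : Fin d → ℤ) (a b : Fin d) : ℝ :=
  if h : a < b then x (plaquette v h) else if h : b < a then -x (plaquette v h) else 0

theorem component_of_lt (x : (lattice d).KCell 2 → ℝ) (v : Fin d → ℤ) {a b : Fin d} (h : a < b) :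
    component x v a b = x (plaquette v h) := dif_pos h

theorem component_addCoboundary (c : (lattice d).KCell 1 → ℝ) (v : Fin d → ℤ) (a b : Fin d) :
    component ((lattice d).addCoboundary 1 ℝ c) v a b =
      (c (edge (v + Pi.single a 1) b) - c (edge v b)) -
        (c (edge (v + Pi.single b 1) a) - c (edge v a)) := by
  unfold component
  split_ifs with h1 h2
  · rw [addCoboundary_plaquette]
  · rw [addCoboundary_plaquette, neg_sub]
  · obtain rfl := le_antisymm (not_lt.1 h2) (not_lt.1 h1)
    rw [sub_self]

theorem component_congr {x y : (lattice d).KCell 2 → ℝ} {v : Fin d → ℤ}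
    (h : ∀ σ : (lattice d).KCell 2, σ.1.1 = v → x σ = y σ) (a b : Fin d) :
    component x v a b = component y v a b := by
  unfold component
  split_ifs with h1 h2
  · exact h _ rfl
  · rw [h _ rfl]
  · rfl

/-- The interior product of a `2`-cochain with the direction `i`. -/
def interiorProduct (i : Fin d) (x : (lattice d).KCell 2 → ℝ) (σ : (lattice d).KCell 1) : ℝ :=
  ∑ b ∈ σ.1.2, component x σ.1.1 i b

theorem interiorProduct_edge (i : Fin d) (x : (lattice d).KCell 2 → ℝ) (v : Fin d → ℤ)
    (b : Fin d) :
    interiorProduct i x (edge v b) = component x v i b :=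
  Finset.sum_singleton _ _

/-- The plaquette spanned by an edge and a direction orthogonal to it. -/
def thicken (i : Fin d) (σ : {σ : (lattice d).KCell 1 // i ∉ σ.1.2}) : (lattice d).KCell 2 :=
  ⟨(σ.1.1.1, insert i σ.1.1.2), trivial, by
    rw [Finset.card_insert_of_notMem σ.2, σ.1.2.2]⟩

theorem thicken_injective (i : Fin d) : Function.Injective (thicken i) := by
  intro σ τ h
  have h1 := congrArg (fun ρ : (lattice d).KCell 2 => ρ.1.1) h
  have h2 := congrArg (fun ρ : (lattice d).KCell 2 => ρ.1.2.erase i) h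
  simp only [thicken, Finset.erase_insert σ.2, Finset.erase_insert τ.2] at h1 h2
  exact Subtype.ext (Subtype.ext (Prod.ext h1 h2))

theorem norm_interiorProduct_thicken (i : Fin d) (x : (lattice d).KCell 2 → ℝ)
    (σ : {σ : (lattice d).KCell 1 // i ∉ σ.1.2}) :
    ‖interiorProduct i x σ.1‖ = ‖x (thicken i σ)‖ := by
  obtain ⟨σ, hσ⟩ := σ
  obtain ⟨v, b, rfl⟩ := exists_eq_edge σ
  have hib : i ≠ b := fun h => hσ (by simp [edge, h])
  rw [interiorProduct_edge]
  unfold component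
  rcases lt_or_gt_of_ne hib with h | h
  · rw [dif_pos h]
    rfl
  · rw [dif_neg h.not_gt, dif_pos h, norm_neg]
    congr 2
    exact Subtype.ext (Prod.ext rfl (Finset.pair_comm b i))

theorem interiorProduct_eq_zero (i : Fin d) (x : (lattice d).KCell 2 → ℝ) (σ : (lattice d).KCell 1)
    (hσ : i ∈ σ.1.2) : interiorProduct i x σ = 0 := by
  obtain ⟨v, b, rfl⟩ := exists_eq_edge σ
  obtain rfl := Finset.mem_singleton.1 hσ
  rw [interiorProduct_edge]
  simp [component]

theorem summable_sq (K : Subcomplex d) {k : ℕ} (x : K.L2Cochain k) :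
    Summable fun σ => ‖x σ‖ ^ 2 := by
  simpa using (memℓp_gen_iff (p := 2) (by norm_num)).1 (lp.memℓp x)

theorem memlp_of_summable_sq {K : Subcomplex d} {k : ℕ} {x : K.KCell k → ℝ}
    (h : Summable fun σ => ‖x σ‖ ^ 2) : Memℓp x 2 :=
  memℓp_gen (by simpa using h)

theorem norm_sq_l2Cochain (K : Subcomplex d) {k : ℕ} (x : K.L2Cochain k) :
    ‖x‖ ^ 2 = ∑' σ, ‖x σ‖ ^ 2 := by
  simpa using lp.norm_rpow_eq_tsum (p := 2) (by norm_num) x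

theorem memlp_interiorProduct (i : Fin d) (x : (lattice d).L2Cochain 2) :
    Memℓp (interiorProduct i x) 2 := by
  refine memlp_of_summable_sq ?_
  rw [← (Subtype.val_injective (p := fun σ : (lattice d).KCell 1 => i ∉ σ.1.2)).summable_iff]
  · refine ((summable_sq _ x).comp_injective (thicken_injective i)).congr fun σ => ?_
    simp only [Function.comp_apply]
    rw [norm_interiorProduct_thicken]
  · intro σ hσ
    have : i ∈ σ.1.2 := by simpa using hσ
    rw [interiorProduct_eq_zero i _ σ this]
    simp

/-- The interior product of a square-summable `2`-cochain with the direction `i`. -/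
def l2Interior (i : Fin d) (x : (lattice d).L2Cochain 2) : (lattice d).L2Cochain 1 :=
  ⟨interiorProduct i x, memlp_interiorProduct i x⟩

/-- Translation of cells by a lattice vector. -/
def translateCell (k : ℕ) (w : Fin d → ℤ) : (lattice d).KCell k ≃ (lattice d).KCell k where
  toFun σ := ⟨(σ.1.1 + w, σ.1.2), trivial, σ.2.2⟩
  invFun σ := ⟨(σ.1.1 - w, σ.1.2), trivial, σ.2.2⟩
  left_inv _ := Subtype.ext (Prod.ext (add_sub_cancel_right _ _) rfl)
  right_inv _ := Subtype.ext (Prod.ext (sub_add_cancel _ _) rfl)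

/-- Translation of square-summable cochains by a lattice vector. -/
def translate {k : ℕ} (w : Fin d → ℤ) (x : (lattice d).L2Cochain k) : (lattice d).L2Cochain k :=
  ⟨fun σ => x (translateCell k w σ), memlp_of_summable_sq
    ((summable_sq _ x).comp_injective (translateCell k w).injective)⟩

theorem norm_translate {k : ℕ} (w : Fin d → ℤ) (x : (lattice d).L2Cochain k) :
    ‖translate w x‖ = ‖x‖ := by
  rw [← sq_eq_sq₀ (norm_nonneg _) (norm_nonneg _), norm_sq_l2Cochain, norm_sq_l2Cochain]
  exact (translateCell k w).tsum_eq fun σ => ‖x σ‖ ^ 2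

theorem eq_zero_of_translate_eq {k : ℕ} {w : Fin d → ℤ} (hw : w ≠ 0) {x : (lattice d).L2Cochain k}
    (hx : translate w x = x) : x = 0 := by
  refine lp.ext (funext fun σ => ?_)
  let f : ℕ → (lattice d).KCell k := fun n => ⟨(σ.1.1 + n • w, σ.1.2), trivial, σ.2.2⟩
  have hf : Function.Injective f := by
    intro m n h
    have h1 : σ.1.1 + m • w = σ.1.1 + n • w :=
      congrArg (fun ρ : (lattice d).KCell k => ρ.1.1) h
    obtain ⟨j, hj⟩ := Function.ne_iff.1 hw
    have h2 := congrFun (add_left_cancel h1) j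
    simp only [Pi.smul_apply, nsmul_eq_mul] at h2
    exact_mod_cast mul_right_cancel₀ hj h2
  have hconst : ∀ n, x (f n) = x σ := by
    intro n
    induction n with
    | zero =>
      have h1 : f 0 = σ := Subtype.ext (Prod.ext (by simp [f]) rfl)
      rw [h1]
    | succ n ih =>
      rw [← ih]
      have h1 : translateCell k w (f n) = f (n + 1) :=
        Subtype.ext (Prod.ext (by simp [f, translateCell, add_smul, add_assoc]) rfl)
      rw [← h1]
      exact congrFun (congrArg Subtype.val hx) (f n)
  have hs := (summable_sq _ x).comp_injective hf
  have : Summable fun _ : ℕ => ‖x σ‖ ^ 2 := hs.congr fun n => by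
    simp only [Function.comp_apply, hconst]
  rw [summable_const_iff] at this
  simpa using this

variable [NeZero d]

theorem exists_local_primitive {x : (lattice d).L2Cochain 2} (hx : x ∈ limitHilbert d)
    {W : Set (Fin d → ℤ)} (hW : W.Finite) :
    ∃ c : (lattice d).KCell 1 → ℝ, ∀ σ : (lattice d).KCell 2, σ.1.1 ∈ W →
      x σ = (lattice d).addCoboundary 1 ℝ c σ := by
  obtain ⟨N, hN⟩ := exists_subset_cube (hW.prod (Set.finite_univ (α := Finset (Fin d))))
  obtain ⟨c, hc⟩ := restrictL2_mem (admissibleCube d N) ⟨x, hx⟩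
  refine ⟨addExtend (admissibleCube d N).1 c, fun σ hσ => ?_⟩
  have h1 : σ.1 ∈ (admissibleCube d N).1.cells := hN N le_rfl ⟨hσ, trivial⟩
  have h2 := addCoboundary_addExtend (admissibleCube d N).1 (c : _ → ℝ) ⟨σ.1, h1, σ.2.2⟩
  exact (congrFun (congrArg Subtype.val hc) ⟨σ.1, h1, σ.2.2⟩).symm.trans h2.symm

/-- The Cartan homotopy formula for translations of closed `2`-cochains. -/
theorem l2Coboundary_l2Interior {x : (lattice d).L2Cochain 2} (hx : x ∈ limitHilbert d)
    (i : Fin d) :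
    (lattice d).l2Coboundary 1 (l2Interior i x) = translate (Pi.single i 1) x - x := by
  refine lp.ext (funext fun σ => ?_)
  obtain ⟨v, a, b, hab, rfl⟩ := exists_eq_plaquette σ
  obtain ⟨c, hc⟩ := exists_local_primitive hx (W := {v, v + Pi.single i 1, v + Pi.single a 1,
    v + Pi.single b 1}) (by simp)
  have hcomp : ∀ w ∈ ({v, v + Pi.single i 1, v + Pi.single a 1, v + Pi.single b 1} :
      Set (Fin d → ℤ)), ∀ e f, component x w e f =
        (c (edge (w + Pi.single e 1) f) - c (edge w f)) -
        (c (edge (w + Pi.single f 1) e) - c (edge w e)) := by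
    intro w hw e f
    rw [← component_addCoboundary]
    exact component_congr (fun σ hσ => hc σ (hσ ▸ hw)) e f
  change (lattice d).addCoboundary 1 ℝ (interiorProduct i x) (plaquette v hab) =
    x (plaquette (v + Pi.single i 1) hab) - x (plaquette v hab)
  rw [addCoboundary_plaquette]
  simp only [interiorProduct_edge]
  rw [← component_of_lt x _ hab, ← component_of_lt x _ hab, hcomp v (by simp),
    hcomp v (by simp), hcomp v (by simp), hcomp _ (by simp), hcomp _ (by simp), hcomp _ (by simp),
    add_right_comm v (Pi.single i 1) (Pi.single a 1),
    add_right_comm v (Pi.single i 1) (Pi.single b 1),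
    add_right_comm v (Pi.single a 1) (Pi.single b 1)]
  ring

theorem limitHilbert_eq_closure :
    limitHilbert d = (LinearMap.range ((lattice d).l2Coboundary 1)).topologicalClosure := by
  set R := (LinearMap.range ((lattice d).l2Coboundary 1)).topologicalClosure with hR
  have hle : R ≤ limitHilbert d := by
    refine Submodule.topologicalClosure_minimal _ ?_ isClosed_limitHilbert
    rintro _ ⟨c, rfl⟩
    exact (Submodule.mem_iInf _).2 fun K => ⟨K.1.restrictL2 1 c, rfl⟩
  refine le_antisymm (fun x hx => ?_) hle
  set y := x - R.starProjection x with hy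
  have hyH : y ∈ limitHilbert d :=
    Submodule.sub_mem _ hx (hle (R.starProjection_apply_mem x))
  have hyR : y ∈ Rᗮ := R.sub_starProjection_mem_orthogonal x
  have horth : inner ℝ (translate (Pi.single 0 1) y - y) y = (0 : ℝ) := by
    refine (Submodule.mem_orthogonal R y).1 hyR _ (Submodule.le_topologicalClosure _ ?_)
    exact ⟨_, l2Coboundary_l2Interior hyH 0⟩
  have h0 : ‖translate (Pi.single 0 1) y - y‖ ^ 2 = 0 := by
    rw [inner_sub_left, real_inner_self_eq_norm_sq] at horth
    rw [norm_sub_sq_real, norm_translate]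
    linarith
  have h1 : translate (Pi.single 0 1) y = y := sub_eq_zero.1 (by simpa using h0)
  have h2 : y = 0 := eq_zero_of_translate_eq (by simp) h1
  rw [sub_eq_zero.1 h2]
  exact R.starProjection_apply_mem x

end CubicalLattice

end

noncomputable section

namespace CubicalLattice

open Subcomplex MeasureTheory

/-! ### Expectations of products of plaquette variables -/

theorem norm_eq_norm_starProjection {E : Type} [NormedAddCommGroup E] [InnerProductSpace ℝ E]
    (S : Submodule ℝ E) [S.HasOrthogonalProjection] (w : E) (l : StrongDual ℝ S)
    (hl : ∀ X : S, l X = inner ℝ w (X : E)) : ‖l‖ = ‖S.starProjection w‖ := by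
  have h1 : l = innerSL ℝ (S.orthogonalProjectionOnto w) := by
    ext X
    rw [hl, innerSL_apply_apply]
    exact (S.inner_orthogonalProjectionOnto_eq_of_mem_right X w).symm
  rw [h1, innerSL_apply_norm]
  rfl

variable {d : ℕ}

theorem norm_exactProj_add_sq (a b : (lattice d).L2Cochain 2) :
    ‖exactProj d (a + b)‖ ^ 2 =
      ‖exactProj d a‖ ^ 2 + ‖exactProj d b‖ ^ 2 + 2 * inner ℝ a (exactProj d b) := by
  have h : inner ℝ (exactProj d a) (exactProj d b) = (inner ℝ a (exactProj d b) : ℝ) := by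
    rw [exactProj, Submodule.inner_starProjection_left_eq_right,
      Submodule.starProjection_eq_self_iff.2 (Submodule.starProjection_apply_mem _ _)]
  rw [map_add, norm_add_sq_real, h]
  ring

variable [NeZero d]

theorem norm_limitJ (χ : PontryaginDual (limitGroup d)) (w : (lattice d).L2Cochain 2)
    (hχ : ∀ X : limitHilbert d, χ (limitExp X) =
      Circle.exp (2 * Real.pi * inner ℝ w (X : (lattice d).L2Cochain 2))) :
    ‖limitJ χ‖ = ‖exactProj d w‖ := by
  have hJ : limitJ χ = (innerSL ℝ w).comp (limitHilbert d).subtypeL :=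
    strongDual_ext_of_exp fun X => (limitJ_spec χ X).symm.trans (hχ X)
  have h1 := norm_eq_norm_starProjection (limitHilbert d) w (limitJ χ) fun X => by
    rw [hJ]
    rfl
  rw [h1, exactProj]
  congr 2
  exact Submodule.starProjection_inj.2 limitHilbert_eq_closure

theorem integral_character {β : ℝ} (hβ : 0 ≤ β) (χ : PontryaginDual (limitGroup d))
    (w : (lattice d).L2Cochain 2)
    (hχ : ∀ X : limitHilbert d, χ (limitExp X) =
      Circle.exp (2 * Real.pi * inner ℝ w (X : (lattice d).L2Cochain 2))) :
    ∫ x, (χ x : ℂ) ∂(heatKernelMeasure (limitJ (d := d)) β) =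
      ((Real.exp (-4 * Real.pi ^ 2 * β * ‖exactProj d w‖ ^ 2) : ℝ) : ℂ) := by
  have h := (isHeatKernelMeasure_heatKernelMeasure (d := d) hβ).2 χ
  rw [integral_conj, norm_limitJ χ w hχ] at h
  rw [← Complex.conj_conj (∫ x, (χ x : ℂ) ∂_), h, Complex.conj_ofReal]

/-- The value at the plaquette `p`, as a character of the limit group. -/
def evalCharacter (p : (lattice d).KCell 2) : PontryaginDual (limitGroup d) :=
  ({ toFun := fun x => x.1 p
     map_one' := rfl
     map_mul' := fun _ _ => rfl
     continuous_toFun := (continuous_apply p).comp continuous_subtype_val } :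
    limitGroup d →ₜ* Circle)

theorem evalCharacter_limitExp (p : (lattice d).KCell 2) (X : limitHilbert d) :
    evalCharacter p (limitExp X) =
      Circle.exp (2 * Real.pi * inner ℝ (delta p) (X : (lattice d).L2Cochain 2)) := by
  have h : inner ℝ (delta p) (X : (lattice d).L2Cochain 2) = X.1 p := by
    rw [delta, lp.inner_single_left]
    simp
  rw [h]
  rfl

theorem integral_wilsonBar {β : ℝ} (hβ : 0 ≤ β) (p : (lattice d).KCell 2) :
    ∫ x, (wilsonBar p x : ℂ) ∂(gaugeMeasure d β) =
      ((Real.exp (-4 * Real.pi ^ 2 * β * ‖exactProj d (delta p)‖ ^ 2) : ℝ) : ℂ) := by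
  rw [integral_gaugeMeasure, ← integral_character hβ (evalCharacter p) _ (evalCharacter_limitExp p)]
  simp only [wilsonBar_dBarHomeomorph_symm]
  rfl

theorem integral_wilsonBar_mul_wilsonBar {β : ℝ} (hβ : 0 ≤ β) (p q : (lattice d).KCell 2) :
    ∫ x, (wilsonBar p x : ℂ) * (wilsonBar q x : ℂ) ∂(gaugeMeasure d β) =
      ((Real.exp (-4 * Real.pi ^ 2 * β * ‖exactProj d (delta p + delta q)‖ ^ 2) : ℝ) : ℂ) := by
  rw [integral_gaugeMeasure, ← integral_character hβ (evalCharacter p * evalCharacter q) _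
    fun X => by
      rw [inner_add_left, mul_add, Circle.exp_add, ← evalCharacter_limitExp,
        ← evalCharacter_limitExp]
      rfl]
  simp only [wilsonBar_dBarHomeomorph_symm]
  rfl

end CubicalLattice

end

theorem proposition4p4 (d : ℕ) [NeZero d] (β : ℝ) (hβ : 0 < β)
    (p q : (CubicalLattice.lattice d).KCell 2) :
    CubicalLattice.connectedTwoPoint β p q =
      ((Real.exp (-4 * Real.pi ^ 2 * β *
          (‖CubicalLattice.exactProj d (CubicalLattice.delta p)‖ ^ 2 +
            ‖CubicalLattice.exactProj d (CubicalLattice.delta q)‖ ^ 2)) *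
        (Real.exp (-8 * Real.pi ^ 2 * β *
          inner ℝ (CubicalLattice.delta p)
            (CubicalLattice.exactProj d (CubicalLattice.delta q))) - 1) : ℝ) : ℂ) := by
  rw [CubicalLattice.connectedTwoPoint, CubicalLattice.integral_wilsonBar_mul_wilsonBar hβ.le,
    CubicalLattice.integral_wilsonBar hβ.le, CubicalLattice.integral_wilsonBar hβ.le,
    CubicalLattice.norm_exactProj_add_sq, ← Complex.ofReal_mul, ← Complex.ofReal_sub,
    mul_sub, mul_one, ← Real.exp_add, ← Real.exp_add]
  congr 3 <;> ring_nf
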